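/- Let $\mathcal F$ be a set of features, partitioned into a set $\mathcal P$ of protected and a set $\mathcal N$ of unprotected features, each feature having a domain; let $\mathbb F$ be the product of the domains, $\mathcal C$ a set of constraints on feature-vectors, and $\mathbb F[\mathcal C]$ the set of $x\in\mathbb F$ that satisfy all constraints. For $S\subseteq\mathcal F$ let $x_S$ be the restriction of $x$ to $S$. For $x\in\mathbb F[\mathcal C]$, $x_A$ *subsumes* $x_B$ if every $y\in\mathbb F[\mathcal C]$ with $y_B=x_B$ satisfies $y_A=x_A$; it *strictly subsumes* $x_B$ if moreover $x_B$ does not subsume $x_A$. The set $\mathcal C$ is *loose* if for all $x\in\mathbb F[\mathcal C]$ and $p\in\mathcal P$, $x_{\{p\}}$ does not strictly subsume $x_{\mathcal N}$. Let $\kappa:\mathbb F[\mathcal C]\to\mathcal K$ be a classifier. A set $S\subseteq\mathcal F$ is a *weak AXp* of the decision $\langle\kappa,x\rangle$ if $\kappa(y)=\kappa(x)$ for all $y\in\mathbb F[\mathcal C]$ with $y_S=x_S$; it is *unfair* if $S\cap\mathcal P\ne\emptyset$. The classifier $\kappa$ is *disentangled* with respect to $\mathcal C$ if, for every $x\in\mathbb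 F[\mathcal C]$, $\mathcal N$ is a weak AXp of $\langle\kappa,x\rangle$ and $x_{\mathcal N}$ is not strictly subsumed by $x_Q$ for any unfair weak AXp $Q$ of $\langle\kappa,x\rangle$. (a) $\mathcal C$ is loose if and only if $$\forall x,y\in\mathbb F[\mathcal C]\ \forall p\in\mathcal P\ \exists z\in\mathbb F[\mathcal C]:\ \bigl(y_{\{p\}}\ne x_{\{p\}}\lor y_{\mathcal N}=x_{\mathcal N}\bigr)\lor\bigl(z_{\mathcal N}=x_{\mathcal N}\land z_{\{p\}}\ne x_{\{p\}}\bigr).$$ (b) $\kappa$ is disentangled with respect to $\mathcal C$ if and only if $$\begin{aligned}\forall x,y\in\mathbb F[\mathcal C]\ \forall Q\subseteq\mathcal F\ \exists z\in\mathbb F[\mathcal C]:\ &\bigl(y_{\mathcal N}\ne x_{\mathcal N}\lor\kappa(y)=\kappa(x)\bigr)\land\bigl(Q\cap\mathcal P=\emptyset\lor(z_Q=x_Q\land\kappa(z)\ne\kappa(x))\\ &\lor(y_Q\ne x_Q\lor y_{\mathcal N}=x_{\mathcal N})\lor(z_{\mathcal N}=x_{\mathcal N}\land z_Q\ne x_Q)\bigr).\end{aligned}$$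 Now consider a class of inputs, each of which specifies a number $n$ of features with their domains, the partition $(\mathcal P,\mathcal N)$ of $\{1,\dots,n\}$ and the set $\mathcal C$ (and, in (d), the classifier $\kappa$ and its set of classes), under an injective encoding of inputs by bit strings and injective encodings of the values of each feature (and, in (d), of the classes) by bit strings. Assume that well-formed inputs are recognizable in polynomial time, that the partition is computable from the input in polynomial time, that the feature-vectors in $\mathbb F[\mathcal C]$ have size polynomially bounded in the size of the input, and that, given an input and a list of bit strings, it can be decided in polynomial time whether the list encodes an element of $\mathbb F[\mathcal C]$. (c) The problem of testing whether $\mathcal C$ is loose belongs to $\Pi_2^{\mathrm P}$. (d) If moreover $\kappa(z)$ can be computed in polynomial time from the input and $z\in\mathbb F[\mathcal C]$, then the problem of testing whether $\kappa$ is disentangled with respect to $\mathcal C$ belongs to $\Pi_2^{\mathrm P}$. Here $L\in\Pi_2^{\mathrm P}$ means that there are a polynomial $q$ and a polynomial-time decidable relation $R$ such that, for all bit strings $w$, $w\in L$ if and only if for every bit string $u$ with $|u|\le q(|w|)$ there is a bit string $v$ with $|v|\le q(|w|)$ and $R(w,u,v)$. -/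

import Mathlib

/-! ### Constrained feature spaces, weak abductive explanations, subsumption -/

section Features

variable {F : Type*} {D : F → Type*} {K : Type*}

/-- `x_S = y_S`: the feature-vectors `x` and `y` agree on the set `S` of features. -/
def AgreeOn (S : Set F) (x y : ∀ i, D i) : Prop :=
  ∀ i ∈ S, x i = y i

/-- The constrained feature space: the feature-vectors that satisfy every constraint of `C`.
A constraint is identified with the set of feature-vectors that satisfy it. -/
def Feasible (C : Set (Set (∀ i, D i))) : Set (∀ i, D i) :=
  {x | ∀ c ∈ C, x ∈ c}

/-- `S` is a weak AXp of the decision `⟨κ, x⟩`. -/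
def IsWeakAXp (C : Set (Set (∀ i, D i))) (κ : Feasible C → K) (x : Feasible C)
    (S : Set F) : Prop :=
  ∀ y : Feasible C, AgreeOn S y.1 x.1 → κ y = κ x

/-- `x_A` subsumes `x_B` : in the constrained space, `y_B = x_B` implies `y_A = x_A`. -/
def Subsumes (C : Set (Set (∀ i, D i))) (x : Feasible C) (A B : Set F) : Prop :=
  ∀ y : Feasible C, AgreeOn B y.1 x.1 → AgreeOn A y.1 x.1

/-- `x_A` strictly subsumes `x_B`. -/
def StrictlySubsumes (C : Set (Set (∀ i, D i))) (x : Feasible C) (A B : Set F) : Prop :=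
  Subsumes C x A B ∧ ¬ Subsumes C x B A

/-- `C` is loose at `x` with respect to the partition `(P, Pᶜ)` of the features into
protected and unprotected ones. -/
def IsLooseAt (C : Set (Set (∀ i, D i))) (P : Set F) (x : Feasible C) : Prop :=
  ∀ p ∈ P, ¬ StrictlySubsumes C x {p} Pᶜ

/-- The set of constraints `C` is loose. -/
def IsLoose (C : Set (Set (∀ i, D i))) (P : Set F) : Prop :=
  ∀ x : Feasible C, IsLooseAt C P x

/-- The decision `⟨κ, x⟩` is disentangled: the set `Pᶜ` of unprotected features is a weak AXp
that is not strictly subsumed by an unfair weak AXp (one that contains a protected feature). -/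
def IsDisentangledAt (C : Set (Set (∀ i, D i))) (P : Set F) (κ : Feasible C → K)
    (x : Feasible C) : Prop :=
  IsWeakAXp C κ x Pᶜ ∧
    ∀ Q : Set F, IsWeakAXp C κ x Q → (Q ∩ P).Nonempty → ¬ StrictlySubsumes C x Q Pᶜ

/-- The classifier `κ` is disentangled in the constrained feature space. -/
def IsDisentangled (C : Set (Set (∀ i, D i))) (P : Set F) (κ : Feasible C → K) : Prop :=
  ∀ x : Feasible C, IsDisentangledAt C P κ x

end Features

/-! ### Polynomial time and the class `Π₂ᴾ` -/

/-- The function `f` is computed by a Turing machine in time polynomial in the length of the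
encoded argument. -/
def PolyTimeComputable {α β Γ Δ : Type} (ea : α → List Γ) (eb : β → List Δ) (f : α → β) : Prop :=
  Nonempty (Turing.TM2ComputableInPolyTime ea eb f)

/-- The predicate `R` is decided by a Turing machine in time polynomial in the length of the
encoded argument. -/
def PolyTimeDecidable {α Γ : Type} (ea : α → List Γ) (R : α → Prop) : Prop :=
  ∃ f : α → Bool, (∀ a, f a = true ↔ R a) ∧ PolyTimeComputable ea Computability.encodeBool f

/-- A tuple of bit strings, written on one tape with the end marker `none` after each string. -/
def tupleCode (l : List (List Bool)) : List (Option Bool) :=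
  l.flatMap fun s => s.map some ++ [none]

/-- `L` belongs to `Π₂ᴾ` : for some polynomial `q` and some polynomial-time decidable relation `R`,
`w ∈ L ↔ ∀ u, |u| ≤ q(|w|) → ∃ v, |v| ≤ q(|w|) ∧ R(w, u, v)`. -/
def InPi2P (L : Set (List Bool)) : Prop :=
  ∃ (q : Polynomial ℕ) (R : List Bool → List Bool → List Bool → Prop),
    PolyTimeDecidable
      (fun t : List Bool × List Bool × List Bool => tupleCode [t.1, t.2.1, t.2.2])
      (fun t => R t.1 t.2.1 t.2.2) ∧
    ∀ w : List Bool, w ∈ L ↔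
      ∀ u : List Bool, u.length ≤ q.eval w.length →
        ∃ v : List Bool, v.length ≤ q.eval w.length ∧ R w u v

/-! ### The two testing problems -/

/-- A class `ι` of problem inputs. The input `a` is written as the bit string `enc a` and
consists of `n a` features with domains `Dom a i`, of the set `P a` of protected features, and of
the set `C a` of constraints. The values of the features are written as bit strings by `code`. -/
structure ConstraintInputs (ι : Type) where
  enc : ι → List Bool
  enc_injective : Function.Injective enc
  n : ι → ℕ
  Dom : ∀ a, Fin (n a) → Type
  code : ∀ a i, Dom a i → List Bool
  code_injective : ∀ a i, Function.Injective (code a i)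
  P : ∀ a, Finset (Fin (n a))
  C : ∀ a, Set (Set (∀ i, Dom a i))

namespace ConstraintInputs

variable {ι : Type} (I : ConstraintInputs ι)

/-- The feature-vector `x` of the input `a`, written as the list of the codes of its values. -/
def vecCode (a : ι) (x : ∀ i, I.Dom a i) : List (List Bool) :=
  List.ofFn fun i => I.code a i (x i)

/-- The inputs are reasonably encoded and the constraints can be checked in polynomial time:
well-formed inputs are recognized, and the protected features are read off from the input,
in polynomial time; the vectors of the constrained feature space have polynomial size, and they are
recognized in polynomial time. -/
structure PolyTimeCheckable : Prop where
  wellFormed : PolyTimeDecidable (fun w : List Bool => w) (fun w => w ∈ Set.range I.enc)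
  partition : PolyTimeComputable I.enc (fun l : List Bool => l)
    (fun a => List.ofFn fun i : Fin (I.n a) => decide (i ∈ I.P a))
  size : ∃ b : Polynomial ℕ, ∀ a, ∀ x ∈ Feasible (I.C a),
    (tupleCode (I.vecCode a x)).length ≤ b.eval (I.enc a).length
  feasible : PolyTimeDecidable
    (fun t : ι × List (List Bool) => tupleCode (I.enc t.1 :: t.2))
    (fun t => ∃ x ∈ Feasible (I.C t.1), I.vecCode t.1 x = t.2)

/-- The problem of testing looseness, as a set of bit strings. -/
def looseness : Set (List Bool) :=
  I.enc '' {a | IsLoose (I.C a) (I.P a : Set (Fin (I.n a)))}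

end ConstraintInputs

/-- A class `ι` of problem inputs that also specify a classifier `κ a` on the constrained feature
space, with values in a set `K a` of classes, which are written as bit strings by `classCode`. -/
structure ClassifierInputs (ι : Type) extends ConstraintInputs ι where
  K : ι → Type
  classCode : ∀ a, K a → List Bool
  classCode_injective : ∀ a, Function.Injective (classCode a)
  κ : ∀ a, Feasible (C a) → K a

namespace ClassifierInputs

variable {ι : Type} (I : ClassifierInputs ι)

/-- `κ(z)` can be computed in polynomial time, for `z` in the constrained feature space. -/
def PolyTimeEvaluable : Prop :=
  PolyTimeComputable
    (fun t : (a : ι) × Feasible (I.C a) =>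
      tupleCode (I.enc t.1 :: I.vecCode t.1 t.2.1))
    (fun l : List Bool => l)
    (fun t => I.classCode t.1 (I.κ t.1 t.2))

/-- The problem of testing disentangledness, as a set of bit strings. -/
def disentangledness : Set (List Bool) :=
  I.enc '' {a | IsDisentangled (I.C a) (I.P a : Set (Fin (I.n a))) (I.κ a)}

end ClassifierInputs

/-! Parts (a) and (b) are prenex normal forms. That `Q` is not a weak AXp, or that `x_Q` does not
subsume `x_N`, is witnessed by one feasible vector `z`. That `N` is a weak AXp, or that `x_N`
subsumes `x_Q`, is a statement about all feasible `y`. Disentangledness says that for all `x` and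
`Q` the universal statement about `N` holds, and that `Q` is fair, or one of the two existential
statements holds, or the second universal one does. Hence the prefix `∀ x y Q ∃ z`
(`isDisentangled_iff_forall_exists`); looseness is the same with `{p}` for `Q`
(`isLoose_iff_forall_exists`).

For (d), the universal string `u` encodes `x`, `y` and `Q`, and the existential string `v` encodes
`z`. The verifier rejects ill-formed `w`, accepts if `x` or `y` is infeasible, rejects if `z` is
infeasible, and otherwise evaluates the quantifier-free matrix. Feasible vectors have polynomial
size, and so does `Q`, because each feature contributes at least an end marker to the code of a
feasible vector.

The bulk of the proof shows that this verifier is a polynomial-time `TM2` machine, built from the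
machines that the hypotheses supply. These are embedded as subroutines with their own stacks and
states (`embed`, `runs_run`, `runs_call`). A small calculus of programs (`Prog.seq`, `Prog.choice`,
single-statement loops) composes them, and `PolyRuns` tracks stack contents and polynomial time
together. Sizes stay polynomial through subroutine calls because a machine lengthens a stack by a
bounded amount per step (`Subroutine.exists_length_le`). The hypotheses describe the machines only
on well-formed inputs, and the classifier only on feasible vectors, so each call is made on the part
of the domain where the earlier tests succeeded (`PolyRuns.ifPop`). The results are
`Implements.polyRuns_verifier` and `polyTimeDecidable_of_polyRuns`; correctness rests on
`condition_eq_true_iff`.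

Part (c) is the case of (d) with a single class: under a constant classifier every set is a weak
AXp, and disentangledness becomes looseness (`isLoose_iff_isDisentangled_const`). -/

open Turing Turing.TM2

namespace StackProgram

/-! ### Relabelling, exact step counts and stack growth of `TM2` machines -/

section Relabel

variable {K : Type} {Γ : K → Type} {Λ Λ' σ : Type}

/-- Rename the labels of a statement by `f`, and let it continue at `e` where it halts. -/
def relabel (f : Λ → Λ') (e : Option Λ') : Stmt Γ Λ σ → Stmt Γ Λ' σ
  | .push k g q => .push k g (relabel f e q)
  | .peek k g q => .peek k g (relabel f e q)
  | .pop k g q => .pop k g (relabel f e q)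
  | .load g q => .load g (relabel f e q)
  | .branch c q₁ q₂ => .branch c (relabel f e q₁) (relabel f e q₂)
  | .goto l => .goto fun s => f (l s)
  | .halt => match e with
    | none => .halt
    | some l => .goto fun _ => l

/-- The configuration that corresponds to `c` after `relabel f e`. -/
def relabelCfg (f : Λ → Λ') (e : Option Λ') (c : Cfg Γ Λ σ) : Cfg Γ Λ' σ :=
  ⟨(c.l.map f).or e, c.var, c.stk⟩

variable [DecidableEq K]

/-- Only the closing `goto` or `halt` changes. A halt becomes a jump within the same step, so
joining two programs costs no extra step. -/
theorem stepAux_relabel (f : Λ → Λ') (e : Option Λ') (q : Stmt Γ Λ σ) (v : σ)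
    (S : ∀ k, List (Γ k)) :
    stepAux (relabel f e q) v S = relabelCfg f e (stepAux q v S) := by
  induction q generalizing v S with
  | branch c q₁ q₂ ih₁ ih₂ => cases h : c v <;> simp [relabel, h, ih₁, ih₂]
  | goto l => simp [relabel, relabelCfg]
  | halt => cases e <;> simp [relabel, relabelCfg]
  | _ => simp [relabel, *]

/-- The machine `m` passes from `c` to `c'` in exactly `n` steps. -/
def StepsIn (m : Λ → Stmt Γ Λ σ) : ℕ → Cfg Γ Λ σ → Cfg Γ Λ σ → Prop
  | 0, c, c' => c = c'
  | n + 1, c, c' => ∃ d, step m c = some d ∧ StepsIn m n d c'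

theorem StepsIn.trans {m : Λ → Stmt Γ Λ σ} {n n' : ℕ} {c d e : Cfg Γ Λ σ}
    (h : StepsIn m n c d) (h' : StepsIn m n' d e) : StepsIn m (n + n') c e := by
  induction n generalizing c with
  | zero => cases h; simpa using h'
  | succ n ih =>
    obtain ⟨c', hc, h⟩ := h
    rw [Nat.succ_add]
    exact ⟨c', hc, ih h⟩

/-- Translation to the form in which Mathlib's `EvalsTo` counts steps. -/
theorem stepsIn_iff_iterate {m : Λ → Stmt Γ Λ σ} {n : ℕ} {c d : Cfg Γ Λ σ} :
    StepsIn m n c d ↔ (flip bind (step m))^[n] (some c) = some d := by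
  induction n generalizing c with
  | zero => simp [StepsIn]
  | succ n ih =>
    have hnone : (flip bind (step m))^[n] none = none :=
      Function.iterate_fixed rfl n
    simp only [StepsIn, Function.iterate_succ_apply]
    change _ ↔ (flip bind (step m))^[n] (step m c) = some d
    cases h : step m c with
    | none => rw [hnone]; simp
    | some c' => simp [ih]

theorem StepsIn.map {Λ₁ σ₁ : Type} {K₁ : Type} [DecidableEq K₁] {Γ₁ : K₁ → Type}
    {m : Λ → Stmt Γ Λ σ} {m' : Λ₁ → Stmt Γ₁ Λ₁ σ₁} (φ : Cfg Γ Λ σ → Cfg Γ₁ Λ₁ σ₁)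
    (hφ : ∀ c d, step m c = some d → step m' (φ c) = some (φ d)) {n : ℕ} {c d : Cfg Γ Λ σ}
    (h : StepsIn m n c d) : StepsIn m' n (φ c) (φ d) := by
  induction n generalizing c with
  | zero => cases h; rfl
  | succ n ih =>
    obtain ⟨c', hc, h⟩ := h
    exact ⟨φ c', hφ _ _ hc, ih h⟩

theorem StepsIn.relabel {m : Λ → Stmt Γ Λ σ} {m' : Λ' → Stmt Γ Λ' σ} (f : Λ → Λ')
    (e : Option Λ') (hm : ∀ l, m' (f l) = StackProgram.relabel f e (m l)) {n : ℕ}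
    {c d : Cfg Γ Λ σ} (h : StepsIn m n c d) :
    StepsIn m' n (relabelCfg f e c) (relabelCfg f e d) := by
  refine h.map _ fun c d hcd => ?_
  obtain ⟨_ | l, v, S⟩ := c
  · simp at hcd
  · simp only [step, Option.some.injEq] at hcd
    subst hcd
    simp [relabelCfg, hm, stepAux_relabel]

/-- The largest number of `push` instructions on a path through a statement. -/
def pushes : Stmt Γ Λ σ → ℕ
  | .push _ _ q => pushes q + 1
  | .peek _ _ q => pushes q
  | .pop _ _ q => pushes q
  | .load _ q => pushes q
  | .branch _ q₁ q₂ => max (pushes q₁) (pushes q₂)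
  | .goto _ => 0
  | .halt => 0

theorem length_stk_stepAux_le (q : Stmt Γ Λ σ) (v : σ) (S : ∀ k, List (Γ k)) (k : K) :
    ((stepAux q v S).stk k).length ≤ (S k).length + pushes q := by
  induction q generalizing v S with
  | push k' f q ih =>
    refine (ih _ _).trans ?_
    rcases eq_or_ne k k' with rfl | h
    · simp [pushes]; omega
    · simp [pushes, h]
  | pop k' f q ih =>
    refine (ih _ _).trans ?_
    rcases eq_or_ne k k' with rfl | h
    · simp [pushes]
    · simp [pushes, h]
  | peek k' f q ih => exact ih _ _
  | load f q ih => exact ih _ _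
  | branch c q₁ q₂ ih₁ ih₂ =>
    have h₁ := ih₁ v S
    have h₂ := ih₂ v S
    cases h : c v <;> simp only [stepAux, h, cond_true, cond_false, pushes] <;> omega
  | goto l => simp [pushes]
  | halt => simp [pushes]

/-- Only `push` lengthens a stack, and one step executes one path through one statement. A time
bound therefore bounds the space. -/
theorem StepsIn.length_stk_le {m : Λ → Stmt Γ Λ σ} {C : ℕ} (hC : ∀ l, pushes (m l) ≤ C) {n : ℕ}
    {c d : Cfg Γ Λ σ} (h : StepsIn m n c d) (k : K) :
    (d.stk k).length ≤ (c.stk k).length + n * C := by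
  induction n generalizing c with
  | zero => cases h; simp
  | succ n ih =>
    obtain ⟨c', hc, h⟩ := h
    refine (ih h).trans ?_
    obtain ⟨_ | l, v, S⟩ := c
    · simp at hc
    · simp only [step, Option.some.injEq] at hc
      subst hc
      have := length_stk_stepAux_le (m l) v S k
      have := hC l
      rw [Nat.succ_mul]
      dsimp only
      omega

end Relabel

/-! ### Sequential composition, loops and branching of programs -/

/-- A program with finitely many labels; where it halts, a subsequent program may take over. -/
structure Prog {K : Type} (Γ : K → Type) (σ : Type) where
  Λ : Type
  [fin : Fintype Λ]
  main : Λ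
  m : Λ → Stmt Γ Λ σ

namespace Prog

variable {K : Type} [DecidableEq K] {Γ : K → Type} {σ : Type}

/-- Started in `s`, the program `P` halts in `s'` after at most `t` steps. -/
def Runs (P : Prog Γ σ) (s s' : σ × ∀ k, List (Γ k)) (t : ℕ) : Prop :=
  ∃ n ≤ t, StepsIn P.m n ⟨some P.main, s.1, s.2⟩ ⟨none, s'.1, s'.2⟩

theorem Runs.mono {P : Prog Γ σ} {s s' : σ × ∀ k, List (Γ k)} {t t' : ℕ} (h : P.Runs s s' t)
    (ht : t ≤ t') : P.Runs s s' t' :=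
  let ⟨n, hn, h⟩ := h
  ⟨n, hn.trans ht, h⟩

theorem Runs.of_eq {P : Prog Γ σ} {s s₁ s₂ : σ × ∀ k, List (Γ k)} {t : ℕ} (h : P.Runs s s₁ t)
    (hs : s₁ = s₂) : P.Runs s s₂ t :=
  hs ▸ h

/-- Run `P`, then `Q`. -/
def seq (P Q : Prog Γ σ) : Prog Γ σ where
  Λ := P.Λ ⊕ Q.Λ
  fin := @instFintypeSum _ _ P.fin Q.fin
  main := .inl P.main
  m := Sum.elim (fun l => relabel .inl (some (.inr Q.main)) (P.m l))
    (fun l => relabel .inr none (Q.m l))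

theorem Runs.seq {P Q : Prog Γ σ} {s s' s'' : σ × ∀ k, List (Γ k)} {t t' : ℕ}
    (h : P.Runs s s' t) (h' : Q.Runs s' s'' t') : (P.seq Q).Runs s s'' (t + t') := by
  obtain ⟨n, hn, h⟩ := h
  obtain ⟨n', hn', h'⟩ := h'
  have h₁ := h.relabel (m' := (P.seq Q).m) (Sum.inl : P.Λ → P.Λ ⊕ Q.Λ) (some (.inr Q.main))
    fun _ => rfl
  have h₂ := h'.relabel (m' := (P.seq Q).m) (Sum.inr : Q.Λ → P.Λ ⊕ Q.Λ) none fun _ => rfl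
  exact ⟨n + n', by omega, h₁.trans h₂⟩

/-- A single statement; it may be iterated by jumps to its only label. -/
def ofStmt (q : Stmt Γ Unit σ) : Prog Γ σ where
  Λ := Unit
  main := ()
  m _ := q

theorem runs_ofStmt_halt {q : Stmt Γ Unit σ} {s s' : σ × ∀ k, List (Γ k)}
    (h : stepAux q s.1 s.2 = ⟨none, s'.1, s'.2⟩) : (ofStmt q).Runs s s' 1 :=
  ⟨1, le_rfl, _, congrArg some h, rfl⟩

theorem runs_ofStmt_goto {q : Stmt Γ Unit σ} {s s' s'' : σ × ∀ k, List (Γ k)} {t : ℕ}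
    (h : stepAux q s.1 s.2 = ⟨some (), s'.1, s'.2⟩) (h' : (ofStmt q).Runs s' s'' t) :
    (ofStmt q).Runs s s'' (t + 1) := by
  obtain ⟨n, hn, h'⟩ := h'
  exact ⟨n + 1, by omega, _, congrArg some h, h'⟩

/-- Execute the statement `q`, which jumps to `true` or `false` for running `P` or `Q`. -/
def choice (q : Stmt Γ Bool σ) (P Q : Prog Γ σ) : Prog Γ σ where
  Λ := Option (P.Λ ⊕ Q.Λ)
  fin := @instFintypeOption _ (@instFintypeSum _ _ P.fin Q.fin)
  main := none
  m
    | none => relabel (fun b => some (cond b (.inl P.main) (.inr Q.main))) none q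
    | some (.inl l) => relabel (fun l => some (.inl l)) none (P.m l)
    | some (.inr l) => relabel (fun l => some (.inr l)) none (Q.m l)

theorem runs_choice_true {q : Stmt Γ Bool σ} {P Q : Prog Γ σ} {s s' s'' : σ × ∀ k, List (Γ k)}
    {t : ℕ} (h : stepAux q s.1 s.2 = ⟨some true, s'.1, s'.2⟩) (h' : P.Runs s' s'' t) :
    (choice q P Q).Runs s s'' (t + 1) := by
  obtain ⟨n, hn, h'⟩ := h'
  have h₂ := h'.relabel (m' := (choice q P Q).m)
    (fun l => (some (.inl l) : Option (P.Λ ⊕ Q.Λ))) none fun _ => rfl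
  refine ⟨n + 1, by omega, _, congrArg some (stepAux_relabel _ _ _ _ _), ?_⟩
  rw [h]
  exact h₂

theorem runs_choice_false {q : Stmt Γ Bool σ} {P Q : Prog Γ σ} {s s' s'' : σ × ∀ k, List (Γ k)}
    {t : ℕ} (h : stepAux q s.1 s.2 = ⟨some false, s'.1, s'.2⟩) (h' : Q.Runs s' s'' t) :
    (choice q P Q).Runs s s'' (t + 1) := by
  obtain ⟨n, hn, h'⟩ := h'
  have h₂ := h'.relabel (m' := (choice q P Q).m)
    (fun l => (some (.inr l) : Option (P.Λ ⊕ Q.Λ))) none fun _ => rfl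
  refine ⟨n + 1, by omega, _, congrArg some (stepAux_relabel _ _ _ _ _), ?_⟩
  rw [h]
  exact h₂

end Prog

/-! ### Programs that call given machines -/

/-- A machine together with translations of the symbol type `A` into its input alphabet
and of its output alphabet into `A`. -/
structure Subroutine (A : Type) where
  tm : FinTM2
  read : A → tm.Γ tm.k₀
  write : tm.Γ tm.k₁ → A

/-- The subroutine turns `x` into `y` in at most `t` steps. -/
def Subroutine.Outputs {A : Type} (M : Subroutine A) (x y : List A) (t : ℕ) : Prop :=
  ∃ o, Nonempty (TM2OutputsInTime M.tm (x.map M.read) (some o) t) ∧ y = o.map M.write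

theorem initList_eq (tm : FinTM2) (s : List (tm.Γ tm.k₀)) :
    initList tm s = ⟨some tm.main, tm.initialState, Function.update (fun _ => []) tm.k₀ s⟩ := by
  unfold initList
  congr 1
  funext k
  by_cases h : k = tm.k₀
  · subst h; simp
  · simp [h]

theorem haltList_eq (tm : FinTM2) (s : List (tm.Γ tm.k₁)) :
    haltList tm s = ⟨none, tm.initialState, Function.update (fun _ => []) tm.k₁ s⟩ := by
  unfold haltList
  congr 1
  funext k
  by_cases h : k = tm.k₁
  · subst h; simp
  · simp [h]

/-- A machine that outputs in Mathlib's sense ends in its initial state, with all stacks but the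
output stack empty. Hence a subroutine can be called again once its output has been removed, and the
verifier itself has to clear its stacks before it halts. -/
theorem nonempty_outputsInTime_iff (tm : FinTM2) (s : List (tm.Γ tm.k₀)) (o : List (tm.Γ tm.k₁))
    (t : ℕ) : Nonempty (TM2OutputsInTime tm s (some o) t) ↔ ∃ n ≤ t, StepsIn tm.m n
      ⟨some tm.main, tm.initialState, Function.update (fun _ => []) tm.k₀ s⟩
      ⟨none, tm.initialState, Function.update (fun _ => []) tm.k₁ o⟩ := by
  rw [← initList_eq, ← haltList_eq]
  constructor
  · rintro ⟨⟨⟨n, h⟩, hn⟩⟩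
    exact ⟨n, hn, stepsIn_iff_iterate.2 h⟩
  · rintro ⟨n, hn, h⟩
    exact ⟨⟨⟨n, stepsIn_iff_iterate.1 h⟩, hn⟩⟩

/-- The constant is the largest number of pushes over the finitely many labels, so it does not
depend on the input. -/
theorem Subroutine.exists_length_le {A : Type} (M : Subroutine A) :
    ∃ C, ∀ x y t, M.Outputs x y t → y.length ≤ x.length + t * C := by
  have := M.tm.ΛFin
  refine ⟨Finset.univ.sup fun l => pushes (M.tm.m l), ?_⟩
  rintro x y t ⟨o, ho, rfl⟩
  obtain ⟨n, hn, h⟩ := (nonempty_outputsInTime_iff _ _ _ _).1 ho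
  have h₁ := h.length_stk_le (fun l => Finset.le_sup (f := fun l => pushes (M.tm.m l))
    (Finset.mem_univ l)) M.tm.k₁
  have h₂ : ((Function.update (fun _ => []) M.tm.k₀ (x.map M.read) :
      ∀ k, List (M.tm.Γ k)) M.tm.k₁).length ≤ x.length := by
    -- The output stack may be the input stack, which initially holds `x`; otherwise it starts
    -- empty.
    by_cases hk : M.tm.k₁ = M.tm.k₀
    · rw [hk]; simp
    · simp [hk]
  simp only [Function.update_self] at h₁
  rw [List.length_map]
  exact h₁.trans (add_le_add h₂ (Nat.mul_le_mul_right _ hn))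

section Call

variable {L J A R : Type} (M : J → Subroutine A)

/-- The index type of the stacks: those of the program itself and those of the subroutines. -/
abbrev StackIndex (L : Type) {J A : Type} (M : J → Subroutine A) : Type :=
  L ⊕ (j : J) × (M j).tm.K

/-- The alphabets of the stacks. -/
abbrev Alphabet (L : Type) {J A : Type} (M : J → Subroutine A) : StackIndex L M → Type
  | .inl _ => A
  | .inr p => (M p.1).tm.Γ p.2

/-- The internal states: registers of type `R`, and the states of the subroutines. -/
abbrev MachineState (R : Type) {J A : Type} (M : J → Subroutine A) : Type :=
  R × ∀ j, (M j).tm.σ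

variable {M}

/-- The contents of all stacks. -/
def allStacks (T : L → List A) (U : ∀ j k, List ((M j).tm.Γ k)) :
    ∀ k, List (Alphabet L M k)
  | .inl l => T l
  | .inr p => U p.1 p.2

@[simp] theorem allStacks_inl (T : L → List A) (U : ∀ j k, List ((M j).tm.Γ k)) (l : L) :
    allStacks T U (.inl l) = T l := rfl

@[simp] theorem allStacks_inr (T : L → List A) (U : ∀ j k, List ((M j).tm.Γ k)) (p) :
    allStacks T U (.inr p) = U p.1 p.2 := rfl

/-- The subroutine states before and after a call. -/
def idleState (M : J → Subroutine A) (j : J) : (M j).tm.σ := (M j).tm.initialState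

/-- The subroutine stacks before and after a call. -/
def idleStacks (M : J → Subroutine A) (j : J) (k : (M j).tm.K) : List ((M j).tm.Γ k) := []

@[simp] theorem idleStacks_apply (j : J) (k : (M j).tm.K) : idleStacks M j k = [] := rfl

variable [DecidableEq L] [DecidableEq J]

@[simp] theorem update_allStacks_inl (T : L → List A) (U : ∀ j k, List ((M j).tm.Γ k)) (l : L)
    (x : List A) :
    Function.update (allStacks T U) (.inl l) x = allStacks (Function.update T l x) U := by
  funext k
  rcases k with l' | p
  · by_cases h : l' = l
    · subst h; simp
    · simp [h]
  · simp

@[simp] theorem update_allStacks_inr (T : L → List A) (U : ∀ j k, List ((M j).tm.Γ k)) (j : J)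
    (k : (M j).tm.K) (x : List ((M j).tm.Γ k)) :
    Function.update (allStacks T U) (.inr ⟨j, k⟩) x =
      allStacks T (Function.update U j (Function.update (U j) k x)) := by
  funext k'
  rcases k' with l' | ⟨j', k'⟩
  · simp
  · by_cases h : j' = j
    · subst h
      by_cases h' : k' = k
      · subst h'; simp
      · simp [h']
    · simp [h]

/-- The statement of the machine `M j`, as a statement of the surrounding machine. -/
def embed (L R : Type) {Λ : Type} (j : J) :
    Stmt (M j).tm.Γ Λ (M j).tm.σ → Stmt (Alphabet L M) Λ (MachineState R M)
  | .push k f q => .push (.inr ⟨j, k⟩) (fun s => f (s.2 j)) (embed L R j q)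
  | .peek k f q =>
    .peek (.inr ⟨j, k⟩) (fun s x => (s.1, Function.update s.2 j (f (s.2 j) x))) (embed L R j q)
  | .pop k f q =>
    .pop (.inr ⟨j, k⟩) (fun s x => (s.1, Function.update s.2 j (f (s.2 j) x))) (embed L R j q)
  | .load f q => .load (fun s => (s.1, Function.update s.2 j (f (s.2 j)))) (embed L R j q)
  | .branch f q₁ q₂ => .branch (fun s => f (s.2 j)) (embed L R j q₁) (embed L R j q₂)
  | .goto f => .goto fun s => f (s.2 j)
  | .halt => .halt

/-- The configuration of the surrounding machine, by the configuration of `M j`. -/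
def embedCfg {Λ : Type} (r : R) (V : ∀ j, (M j).tm.σ) (T : L → List A)
    (U : ∀ j k, List ((M j).tm.Γ k)) (j : J) (c : Cfg (M j).tm.Γ Λ (M j).tm.σ) :
    Cfg (Alphabet L M) Λ (MachineState R M) :=
  ⟨c.l, (r, Function.update V j c.var), allStacks T (Function.update U j c.stk)⟩

/-- An embedded statement touches only the `j`-th state and the stacks with index `j`, so one step
of `M j` corresponds to one step of the surrounding machine. -/
theorem stepAux_embed {Λ : Type} (r : R) (V : ∀ j, (M j).tm.σ) (T : L → List A)
    (U : ∀ j k, List ((M j).tm.Γ k)) (j : J) (q : Stmt (M j).tm.Γ Λ (M j).tm.σ)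
    (v : (M j).tm.σ) (S : ∀ k, List ((M j).tm.Γ k)) :
    stepAux (embed L R j q) (r, Function.update V j v) (allStacks T (Function.update U j S)) =
      embedCfg r V T U j (stepAux q v S) := by
  induction q generalizing v S with
  | branch c q₁ q₂ ih₁ ih₂ => cases h : c v <;> simp [embed, h, ih₁, ih₂]
  | goto l => simp [embed, embedCfg]
  | halt => simp [embed, embedCfg]
  | _ => simp [embed, *]

/-- Run the machine `M j`. -/
def run (L R : Type) (j : J) : Prog (Alphabet L M) (MachineState R M) where
  Λ := (M j).tm.Λ
  fin := (M j).tm.ΛFin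
  main := (M j).tm.main
  m l := embed L R j ((M j).tm.m l)

@[simp] theorem update_idleStacks (j : J) (k : (M j).tm.K) :
    Function.update (idleStacks M) j (Function.update (idleStacks M j) k []) = idleStacks M := by
  rw [show Function.update (idleStacks M j) k [] = idleStacks M j from
    Function.update_eq_self (f := idleStacks M j) _]
  exact Function.update_eq_self (f := idleStacks M) _

theorem runs_run (r : R) (T : L → List A) (j : J) {x : List ((M j).tm.Γ (M j).tm.k₀)}
    {y : List ((M j).tm.Γ (M j).tm.k₁)} {t : ℕ}
    (h : Nonempty (TM2OutputsInTime (M j).tm x (some y) t)) :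
    (run L R j).Runs
      ((r, idleState M), allStacks T (Function.update (idleStacks M) j
        (Function.update (idleStacks M j) (M j).tm.k₀ x)))
      ((r, idleState M), allStacks T (Function.update (idleStacks M) j
        (Function.update (idleStacks M j) (M j).tm.k₁ y))) t := by
  obtain ⟨n, hn, h⟩ := (nonempty_outputsInTime_iff _ _ _ _).1 h
  refine ⟨n, hn, ?_⟩
  have := h.map (m' := (run L R j).m) (embedCfg r (idleState M) T (idleStacks M) j) ?_
  · have hV : Function.update (idleState M) j (M j).tm.initialState = idleState M :=
      Function.update_eq_self j _
    simp only [embedCfg, hV] at this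
    exact this
  · rintro ⟨_ | l, v, S⟩ d hd
    · cases hd
    · obtain rfl := Option.some.inj hd
      exact congrArg some (stepAux_embed r _ T _ j _ v S)

end Call

/-! ### Elementary stack operations and their effect -/

/-- The symbols on the stacks of a program: bits and an end marker. -/
abbrev Symb : Type := Option Bool

/-- The registers: four for symbols read from stacks (`none` if the stack was empty),
and five flags. -/
structure Regs where
  a : Option Symb
  b : Option Symb
  c : Option Symb
  d : Option Symb
  flag : Fin 5 → Bool

noncomputable instance : Fintype Regs :=
  Fintype.ofInjective
    (fun r : Regs => (r.a, r.b, r.c, r.d, r.flag)) fun r r' h => by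
      cases r; cases r'; simp_all

/-- The registers before and after each operation. -/
def Regs.init : Regs := ⟨none, none, none, none, fun _ => true⟩

section Gadgets

variable {L J : Type} {M : J → Subroutine Symb}

/-- The state of the whole machine between two operations, by the contents of its own stacks. -/
def idle (M : J → Subroutine Symb) (T : L → List Symb) :
    MachineState Regs M × ∀ k, List (Alphabet L M k) :=
  ((.init, idleState M), allStacks T (idleStacks M))

variable (M) in
/-- The type of the statements with a single label. -/
abbrev Body (L : Type) (Λ : Type := Unit) : Type :=
  Stmt (Alphabet L M) Λ (MachineState Regs M)

variable (M) in
/-- The type of the programs. -/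
abbrev Program (L : Type) : Type 1 := Prog (Alphabet L M) (MachineState Regs M)

/-- Reset the registers. -/
def reset {Λ : Type} (q : Body M L Λ) : Body M L Λ :=
  .load (fun s => (.init, s.2)) q

/-- Pop a symbol into the register `a`. -/
def popA {Λ : Type} (k : L) (q : Body M L Λ) : Body M L Λ :=
  .pop (.inl k) (fun s x => ({ s.1 with a := x }, s.2)) q

/-- Pop a symbol into the register `b`. -/
def popB {Λ : Type} (k : L) (q : Body M L Λ) : Body M L Λ :=
  .pop (.inl k) (fun s x => ({ s.1 with b := x }, s.2)) q

/-- Pop a symbol into the register `c`. -/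
def popC {Λ : Type} (k : L) (q : Body M L Λ) : Body M L Λ :=
  .pop (.inl k) (fun s x => ({ s.1 with c := x }, s.2)) q

/-- Pop a symbol into the register `d`. -/
def popD {Λ : Type} (k : L) (q : Body M L Λ) : Body M L Λ :=
  .pop (.inl k) (fun s x => ({ s.1 with d := x }, s.2)) q

/-- Push a symbol that depends on the registers. -/
def pushR {Λ : Type} (k : L) (f : Regs → Symb) (q : Body M L Λ) : Body M L Λ :=
  .push (.inl k) (fun s => f s.1) q

/-- Branch according to the registers. -/
def ifR {Λ : Type} (f : Regs → Bool) (q q' : Body M L Λ) : Body M L Λ :=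
  .branch (fun s => f s.1) q q'

/-- Apply a function to the registers. -/
def mapR {Λ : Type} (f : Regs → Regs) (q : Body M L Λ) : Body M L Λ :=
  .load (fun s => (f s.1, s.2)) q

/-- Repeat the statement. -/
def again : Body M L := .goto fun _ => ()

/-- Move the contents of `src` to `dst`, in reverse order. -/
def move (M : J → Subroutine Symb) (src dst : L) : Program M L :=
  .ofStmt <| popA src <| ifR (fun r => r.a.isSome)
    (pushR dst (fun r => r.a.getD none) <| reset again) (reset .halt)

/-- Move the contents of `src` to both `dst` and `dst'`, in reverse order. -/
def moveBoth (M : J → Subroutine Symb) (src dst dst' : L) : Program M L :=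
  .ofStmt <| popA src <| ifR (fun r => r.a.isSome)
    (pushR dst (fun r => r.a.getD none) <| pushR dst' (fun r => r.a.getD none) <| reset again)
    (reset .halt)

/-- Empty the stack `src`. -/
def clear (M : J → Subroutine Symb) (src : L) : Program M L :=
  .ofStmt <| popA src <| ifR (fun r => r.a.isSome) (reset again) (reset .halt)

/-- Push the symbol `s`. -/
def pushSymb (M : J → Subroutine Symb) (dst : L) (s : Symb) : Program M L :=
  .ofStmt <| pushR dst (fun _ => s) .halt

/-- Move a bit string up to its end marker from `src` to `dst`, in reverse order. -/
def takeString (M : J → Subroutine Symb) (src dst : L) : Program M L :=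
  .ofStmt <| popA src <| ifR (fun r => (r.a.getD none).isSome)
    (pushR dst (fun r => r.a.getD none) <| reset again) (reset .halt)

/-- Push to `dst` whether `src` and `src'` have the same contents; empty them. -/
def compare (M : J → Subroutine Symb) (src src' dst : L) : Program M L :=
  .ofStmt <| popA src <| popB src' <| ifR (fun r => r.a.isSome || r.b.isSome)
    (mapR (fun r => { Regs.init with flag := fun i => r.flag i && r.a == r.b }) again)
    (pushR dst (fun r => some (r.flag 0)) <| reset .halt)

/-- Decode symbols from the bits on `src`, and push them to `dst`: `1b` means the bit `b`, which is
ignored as long as `dst` is empty, `01` means the end marker, `00` means that decoding ends. -/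
def decode (M : J → Subroutine Symb) (src dst : L) : Program M L :=
  .ofStmt <| popA src <| popB src <|
    ifR (fun r => r.a == some (some true) && r.b.isSome)
      (.peek (.inl dst) (fun s x => ({ s.1 with c := x }, s.2)) <|
        ifR (fun r => r.c.isSome) (pushR dst (fun r => r.b.getD none) <| reset again)
          (reset again)) <|
      ifR (fun r => r.b == some (some true)) (pushR dst (fun _ => none) <| reset again)
        (reset .halt)

/-- Compare the bit strings in the tuples on `src` and `src'`, and push the results to `dst`. -/
def compareEach (M : J → Subroutine Symb) (src src' dst : L) : Program M L :=
  .ofStmt <| popA src <| popB src' <|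
    ifR (fun r => r.a.isSome && r.b.isSome)
      (ifR (fun r => r.a == some none)
        (ifR (fun r => r.b == some none)
          (pushR dst (fun r => some (r.flag 0)) <| reset again)
          (pushR src (fun _ => none) <|
            mapR (fun _ => { Regs.init with flag := fun _ => false }) again))
        (ifR (fun r => r.b == some none)
          (pushR src' (fun _ => none) <|
            mapR (fun _ => { Regs.init with flag := fun _ => false }) again)
          (mapR (fun r => { Regs.init with flag := fun i => r.flag i && r.a == r.b }) again)))
      (reset .halt)

/-- Pop the truth value on `k`, and run `P` or `Q`. -/
def ifPop (k : L) (P Q : Program M L) : Program M L :=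
  .choice (popA k <| .branch (fun s => s.1.a == some (some true))
    (reset <| .goto fun _ => true) (reset <| .goto fun _ => false)) P Q

/-- Move the contents of `src` to the input stack of the machine `M j`, in reverse order. -/
def feed (M : J → Subroutine Symb) (j : J) (src : L) : Program M L :=
  .ofStmt <| popA src <| ifR (fun r => r.a.isSome)
    (.push (.inr ⟨j, (M j).tm.k₀⟩) (fun s => (M j).read (s.1.a.getD none)) <| reset again)
    (reset .halt)

/-- Move the contents of the output stack of the machine `M j` to `dst`, in reverse order. -/
def drain (M : J → Subroutine Symb) (j : J) (dst : L) : Program M L :=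
  .ofStmt <| .pop (.inr ⟨j, (M j).tm.k₁⟩)
    (fun s x => ({ s.1 with a := x.map (M j).write }, s.2)) <|
    ifR (fun r => r.a.isSome)
    (pushR dst (fun r => r.a.getD none) <| reset again) (reset .halt)

variable [DecidableEq L] [DecidableEq J]

/-- Run the machine `M j` on the contents of `src` in reverse order, and move its output to `dst`,
again in reverse order. -/
def call (M : J → Subroutine Symb) (j : J) (src dst : L) : Program M L :=
  (feed M j src).seq <| (run L Regs j).seq <| drain M j dst

attribute [local simp] idle reset popA popB popC popD pushR ifR mapR again

theorem update_update_of_ne {src dst : L} (h : src ≠ dst) (T : L → List Symb) (x : List Symb) :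
    Function.update (Function.update T src x) dst (T dst) = Function.update T src x :=
  Function.update_eq_self_iff.2 (by simp [h.symm])

theorem runs_move {src dst : L} (h : src ≠ dst) (T : L → List Symb) :
    (move M src dst).Runs (idle M T) (idle M (Function.update (Function.update T src [])
      dst ((T src).reverse ++ T dst))) ((T src).length + 1) := by
  generalize hx : T src = x
  induction x generalizing T with
  | nil =>
    apply Prog.runs_ofStmt_halt
    simp [hx, update_update_of_ne h, Regs.init]
  | cons s x ih =>
    refine Prog.runs_ofStmt_goto
      (s' := idle M (Function.update (Function.update T src x) dst (s :: T dst))) ?_ ?_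
    · simp [hx, h.symm, Regs.init]
    · refine (ih (Function.update (Function.update T src x) dst (s :: T dst)) (by simp [h])).of_eq (congrArg (idle M) ?_)
      funext k
      by_cases h₁ : k = dst <;> by_cases h₂ : k = src <;> simp_all

theorem runs_moveBoth {src dst dst' : L} (h : src ≠ dst) (h' : src ≠ dst') (h'' : dst ≠ dst')
    (T : L → List Symb) :
    (moveBoth M src dst dst').Runs (idle M T)
      (idle M (Function.update (Function.update (Function.update T src [])
        dst ((T src).reverse ++ T dst)) dst' ((T src).reverse ++ T dst')))
      ((T src).length + 1) := by
  generalize hx : T src = x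
  induction x generalizing T with
  | nil =>
    apply Prog.runs_ofStmt_halt
    have : Function.update (Function.update (Function.update T src []) dst (T dst)) dst' (T dst')
        = Function.update T src [] := by
      funext k
      by_cases h₁ : k = dst <;> by_cases h₂ : k = src <;> by_cases h₃ : k = dst' <;> simp_all
    simp [hx, this, Regs.init]
  | cons s x ih =>
    refine Prog.runs_ofStmt_goto
      (s' := idle M (Function.update (Function.update (Function.update T src x) dst (s :: T dst))
        dst' (s :: T dst'))) ?_ ?_
    · simp [hx, h.symm, h'.symm, h''.symm, Regs.init]
    · refine (ih (Function.update (Function.update (Function.update T src x) dst (s :: T dst))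
        dst' (s :: T dst')) (by simp [h, h'])).of_eq (congrArg (idle M) ?_)
      funext k
      by_cases h₁ : k = dst <;> by_cases h₂ : k = src <;> by_cases h₃ : k = dst' <;> simp_all

theorem runs_clear {src : L} (T : L → List Symb) :
    (clear M src).Runs (idle M T) (idle M (Function.update T src [])) ((T src).length + 1) := by
  generalize hx : T src = x
  induction x generalizing T with
  | nil =>
    apply Prog.runs_ofStmt_halt
    simp [hx, Regs.init]
  | cons s x ih =>
    refine Prog.runs_ofStmt_goto (s' := idle M (Function.update T src x)) ?_ ?_
    · simp [hx, Regs.init]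
    · exact (ih (Function.update T src x) (by simp)).of_eq (by simp)

theorem runs_pushSymb {dst : L} (s : Symb) (T : L → List Symb) :
    (pushSymb M dst s).Runs (idle M T) (idle M (Function.update T dst (s :: T dst))) 1 :=
  Prog.runs_ofStmt_halt (by simp)

theorem runs_takeString {src dst : L} (h : src ≠ dst) (T : L → List Symb) (x : List Bool)
    (y : List Symb) (hx : T src = x.map some ++ none :: y) :
    (takeString M src dst).Runs (idle M T) (idle M (Function.update (Function.update T src y)
      dst ((x.map some).reverse ++ T dst))) (x.length + 1) := by
  induction x generalizing T with
  | nil =>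
    apply Prog.runs_ofStmt_halt
    simp_all [update_update_of_ne h, Regs.init]
  | cons s x ih =>
    refine Prog.runs_ofStmt_goto (s' := idle M (Function.update (Function.update T src
      (x.map some ++ none :: y)) dst (some s :: T dst))) ?_ ?_
    · simp [hx, h.symm, Regs.init]
    · refine (ih (Function.update (Function.update T src
        (x.map some ++ none :: y)) dst (some s :: T dst)) (by simp [h])).of_eq (congrArg (idle M) ?_)
      funext k
      by_cases h₁ : k = dst <;> by_cases h₂ : k = src <;> simp_all

theorem runs_ifPop_true {k : L} {P Q : Program M L} {T T' : L → List Symb} {x : List Symb} {t : ℕ}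
    (hk : T k = some true :: x) (h : P.Runs (idle M (Function.update T k x)) (idle M T') t) :
    (ifPop k P Q).Runs (idle M T) (idle M T') (t + 1) :=
  Prog.runs_choice_true (s' := idle M (Function.update T k x)) (by simp [hk]) h

theorem runs_ifPop_false {k : L} {P Q : Program M L} {T T' : L → List Symb} {x : List Symb} {t : ℕ}
    (hk : T k = some false :: x) (h : Q.Runs (idle M (Function.update T k x)) (idle M T') t) :
    (ifPop k P Q).Runs (idle M T) (idle M T') (t + 1) :=
  Prog.runs_choice_false (s' := idle M (Function.update T k x)) (by simp [hk]) h

theorem runs_feed (j : J) {src : L} (T : L → List Symb) (z : List ((M j).tm.Γ (M j).tm.k₀)) :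
    (feed M j src).Runs
      ((.init, idleState M), allStacks T (Function.update (idleStacks M) j
        (Function.update (idleStacks M j) (M j).tm.k₀ z)))
      ((.init, idleState M), allStacks (Function.update T src []) (Function.update (idleStacks M) j
        (Function.update (idleStacks M j) (M j).tm.k₀ (((T src).map (M j).read).reverse ++ z))))
      ((T src).length + 1) := by
  generalize hx : T src = x
  induction x generalizing T z with
  | nil =>
    apply Prog.runs_ofStmt_halt
    simp [hx, Regs.init]
  | cons s x ih =>
    refine Prog.runs_ofStmt_goto (s' := ((.init, idleState M),
      allStacks (Function.update T src x) (Function.update (idleStacks M) j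
        (Function.update (idleStacks M j) (M j).tm.k₀ ((M j).read s :: z))))) ?_ ?_
    · simp [hx, Regs.init]
    · exact (ih (Function.update T src x) ((M j).read s :: z) (by simp)).of_eq (by simp)

theorem runs_drain (j : J) {dst : L} (T : L → List Symb) (z : List ((M j).tm.Γ (M j).tm.k₁)) :
    (drain M j dst).Runs
      ((.init, idleState M), allStacks T (Function.update (idleStacks M) j
        (Function.update (idleStacks M j) (M j).tm.k₁ z)))
      (idle M (Function.update T dst ((z.map (M j).write).reverse ++ T dst))) (z.length + 1) := by
  induction z generalizing T with
  | nil =>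
    apply Prog.runs_ofStmt_halt
    simp [Regs.init]
  | cons s z ih =>
    refine Prog.runs_ofStmt_goto (s' := ((.init, idleState M),
      allStacks (Function.update T dst ((M j).write s :: T dst)) (Function.update (idleStacks M) j
        (Function.update (idleStacks M j) (M j).tm.k₁ z)))) ?_ ?_
    · simp [Regs.init]
    · exact (ih (Function.update T dst ((M j).write s :: T dst))).of_eq (by simp)

/-- `feed` and `drain` reverse the order. The argument must therefore lie reversed on `src`, as
`copy` leaves it, and the result arrives reversed on `dst`. -/
theorem runs_call {j : J} {src dst : L} (h : src ≠ dst) (T : L → List Symb) {x y : List Symb}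
    {t : ℕ} (hx : T src = x.reverse) (hy : (M j).Outputs x y t) :
    (call M j src dst).Runs (idle M T) (idle M (Function.update (Function.update T src [])
      dst (y.reverse ++ T dst))) (x.length + t + y.length + 2) := by
  obtain ⟨o, ho, rfl⟩ := hy
  have h₁ := runs_feed (M := M) j (src := src) T []
  have h₂ := runs_run (L := L) Regs.init (Function.update T src []) j ho
  have h₃ := runs_drain (M := M) j (dst := dst) (Function.update T src []) o
  rw [update_idleStacks, hx] at h₁
  simp only [List.map_reverse, List.reverse_reverse, List.append_nil, List.length_reverse] at h₁
  rw [Function.update_of_ne h.symm] at h₃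
  refine (h₁.seq (h₂.seq h₃)).mono ?_
  simp only [List.length_map]
  omega

theorem runs_compare {src src' dst : L} (h : src ≠ src') (h₁ : src ≠ dst) (h₂ : src' ≠ dst)
    (T : L → List Symb) :
    (compare M src src' dst).Runs (idle M T)
      (idle M (Function.update (Function.update (Function.update T src []) src' [])
        dst (some (decide (T src = T src')) :: T dst)))
      ((T src).length + (T src').length + 1) := by
  -- The loop carries its partial verdict in the flags, so the induction has to run over an
  -- arbitrary flag `f`.
  have key : ∀ (n : ℕ) (T : L → List Symb) (f : Bool), (T src).length + (T src').length ≤ n →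
      (compare M src src' dst).Runs
      ((⟨none, none, none, none, fun _ => f⟩, idleState M), allStacks T (idleStacks M))
      (idle M (Function.update (Function.update (Function.update T src []) src' [])
        dst (some (f && decide (T src = T src')) :: T dst))) (n + 1) := by
    intro n
    induction n with
    | zero =>
      intro T f hn
      have hs : T src = [] := List.eq_nil_of_length_eq_zero (by omega)
      have hs' : T src' = [] := List.eq_nil_of_length_eq_zero (by omega)
      apply Prog.runs_ofStmt_halt
      simp [hs, hs', h.symm, h₁.symm, h₂.symm]
    | succ n ih =>
      intro T f hn
      by_cases hnil : T src = [] ∧ T src' = []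
      · refine Prog.Runs.mono (t := 1) (Prog.runs_ofStmt_halt ?_) (by omega)
        simp [hnil.1, hnil.2, h.symm, h₁.symm, h₂.symm]
      · have hlen : (T src).tail.length + (T src').tail.length ≤ n := by
          rcases hs : T src with _ | ⟨s, x⟩ <;> rcases hs' : T src' with _ | ⟨s', x'⟩ <;>
            simp_all <;> omega
        refine Prog.runs_ofStmt_goto (s' := ((⟨none, none, none, none,
          fun _ => f && (T src).head? == (T src').head?⟩, idleState M),
          allStacks (Function.update (Function.update T src (T src).tail) src' (T src').tail)
            (idleStacks M))) ?_ ?_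
        · have : ((T src).head?.isSome || (T src').head?.isSome) = true := by
            rcases hs : T src with _ | ⟨s, x⟩ <;> rcases hs' : T src' with _ | ⟨s', x'⟩ <;>
              simp_all
          simp [this, h.symm, Regs.init]
        · refine (ih (Function.update (Function.update T src (T src).tail) src' (T src').tail)
            (f && (T src).head? == (T src').head?) (by simpa [h] using hlen)).of_eq
            (congrArg (idle M) ?_)
          -- Two lists are equal iff their `head?` and their tails are equal; the value `none` for
          -- an empty list covers different lengths.
          have hd : (f && decide (T src = T src')) = (f && (T src).head? == (T src').head? &&
              decide ((T src).tail = (T src').tail)) := by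
            rw [Bool.eq_iff_iff]
            rcases hs : T src with _ | ⟨s, x⟩ <;> rcases hs' : T src' with _ | ⟨s', x'⟩ <;>
              simp_all [and_assoc]
            exact fun _ _ => decide_eq_true_iff.symm
          rw [hd]
          funext k
          by_cases h₃ : k = dst <;> by_cases h₄ : k = src <;> by_cases h₅ : k = src' <;>
            simp_all
  exact (key _ T true le_rfl).of_eq (by simp)

/-- The result of decoding `x` if the stack of the results contains `acc`,
and the part of `x` that is left over. -/
def decodeFrom : List Symb → List Symb → List Symb × List Symb
  | s :: s' :: x, acc =>
    if s = some true then decodeFrom x (if acc = [] then [] else s' :: acc)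
    else if s' = some true then decodeFrom x (none :: acc)
    else (acc, x)
  | _, acc => (acc, [])

theorem runs_decode {src dst : L} (h : src ≠ dst) (T : L → List Symb) :
    (decode M src dst).Runs (idle M T)
      (idle M (Function.update (Function.update T src (decodeFrom (T src) (T dst)).2)
        dst (decodeFrom (T src) (T dst)).1)) ((T src).length + 1) := by
  -- Each repeated round removes two symbols, so the induction is on a bound for the length rather
  -- than on the list.
  have key : ∀ (n : ℕ) (T : L → List Symb), (T src).length ≤ n →
      (decode M src dst).Runs (idle M T)
      (idle M (Function.update (Function.update T src (decodeFrom (T src) (T dst)).2)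
        dst (decodeFrom (T src) (T dst)).1)) (n + 1) := by
    intro n
    induction n with
    | zero =>
      intro T hn
      have hs : T src = [] := List.eq_nil_of_length_eq_zero (by omega)
      apply Prog.runs_ofStmt_halt
      simp [hs, decodeFrom, update_update_of_ne h, Regs.init]
    | succ n ih =>
      intro T hn
      have hup : ∀ x y : List Symb, (decodeFrom x y) = (decodeFrom
          (Function.update (Function.update T src x) dst y src)
          (Function.update (Function.update T src x) dst y dst)) := by
        intro x y; simp [h]
      have hfin : ∀ x y : List Symb, (x.length ≤ n) → (decode M src dst).Runs
          (idle M (Function.update (Function.update T src x) dst y))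
          (idle M (Function.update (Function.update T src (decodeFrom x y).2)
            dst (decodeFrom x y).1)) (n + 1) := by
        intro x y hx
        refine (ih (Function.update (Function.update T src x) dst y) (by simpa [h] using hx)).of_eq
          (congrArg (idle M) ?_)
        rw [← hup]
        funext k
        by_cases h₁ : k = dst <;> by_cases h₂ : k = src <;> simp_all
      rcases hs : T src with _ | ⟨s, _ | ⟨s', x⟩⟩
      · refine Prog.Runs.mono (t := 1) (Prog.runs_ofStmt_halt ?_) (by omega)
        simp [hs, decodeFrom, update_update_of_ne h, Regs.init]
      · refine Prog.Runs.mono (t := 1) (Prog.runs_ofStmt_halt ?_) (by omega)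
        simp [hs, decodeFrom, update_update_of_ne h, Regs.init]
      · have hx : x.length ≤ n := by rw [hs] at hn; simp at hn; omega
        by_cases h₁ : s = some true
        -- On an empty `dst` the data symbol is dropped, since no end marker lies below it yet.
        · rcases hd : T dst with _ | ⟨s₂, y⟩
          · have := hfin x [] hx
            refine Prog.runs_ofStmt_goto ?_ (this.of_eq ?_)
            · have hu := update_update_of_ne h T x
              rw [hd] at hu
              simp [hs, h₁, h.symm, hd, Regs.init, hu]
            · simp [decodeFrom, h₁]
          · have := hfin x (s' :: s₂ :: y) hx
            refine Prog.runs_ofStmt_goto ?_ (this.of_eq ?_)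
            · simp [hs, h₁, h.symm, hd, Regs.init]
            · simp [decodeFrom, h₁]
        · have h₁' : (s == some true) = false := by simpa using h₁
          by_cases h₂ : s' = some true
          · have := hfin x (none :: T dst) hx
            refine Prog.runs_ofStmt_goto ?_ (this.of_eq ?_)
            · simp [hs, h₁', h₂, h.symm, Regs.init]
            · simp [decodeFrom, h₁, h₂]
          · refine Prog.Runs.mono (t := 1) (Prog.runs_ofStmt_halt ?_) (by omega)
            have h₂' : (s' == some true) = false := by simpa using h₂
            simp [hs, h₁, h₁', h₂, h₂', decodeFrom, update_update_of_ne h, Regs.init]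
  exact key _ T le_rfl

@[simp] theorem tupleCode_nil : tupleCode [] = [] := rfl

theorem tupleCode_cons (s : List Bool) (l : List (List Bool)) :
    tupleCode (s :: l) = s.map some ++ none :: tupleCode l := by
  simp [tupleCode]

@[simp] theorem tupleCode_nil_cons (l : List (List Bool)) :
    tupleCode ([] :: l) = none :: tupleCode l := by
  simp [tupleCode]

@[simp] theorem tupleCode_cons_cons (b : Bool) (s : List Bool) (l : List (List Bool)) :
    tupleCode ((b :: s) :: l) = some b :: tupleCode (s :: l) := by
  simp [tupleCode]

/-- The truth values of the equalities between the entries of two lists. -/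
def equalities (l l' : List (List Bool)) : List Symb :=
  List.zipWith (fun s s' => some (decide (s = s'))) l l'

/-- Both tuples are read in lockstep. If one string ends early, its end marker is pushed back and
the flag becomes false, so the surplus of the longer string is consumed before the verdict for this
entry is pushed. -/
theorem runs_compareEach {src src' dst : L} (h : src ≠ src') (h₁ : src ≠ dst) (h₂ : src' ≠ dst)
    (T : L → List Symb) {l l' : List (List Bool)} (hl : l.length = l'.length)
    (hs : T src = tupleCode l) (hs' : T src' = tupleCode l') :
    (compareEach M src src' dst).Runs (idle M T)
      (idle M (Function.update (Function.update (Function.update T src []) src' [])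
        dst ((equalities l l').reverse ++ T dst)))
      ((T src).length + (T src').length + 1) := by
  -- The flag `f` records the part of the current strings already read. It affects only the first
  -- remaining entry, hence `modifyHead`.
  have key : ∀ (n : ℕ) (T : L → List Symb) (f : Bool) (l l' : List (List Bool)),
      l.length = l'.length → T src = tupleCode l → T src' = tupleCode l' →
      (tupleCode l).length + (tupleCode l').length ≤ n →
      (compareEach M src src' dst).Runs
      ((⟨none, none, none, none, fun _ => f⟩, idleState M), allStacks T (idleStacks M))
      (idle M (Function.update (Function.update (Function.update T src []) src' [])
        dst (((equalities l l').modifyHead (Option.map (f && ·))).reverse ++ T dst))) (n + 1) := by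
    intro n
    induction n with
    | zero =>
      intro T f l l' hl hs hs' hn
      rcases l with _ | ⟨_ | ⟨b, s⟩, l⟩ <;> rcases l' with _ | ⟨_ | ⟨b', s'⟩, l'⟩ <;>
        simp at hl hn
      apply Prog.runs_ofStmt_halt
      have hdst : Function.update (Function.update (Function.update T src []) src' []) dst (T dst) =
          Function.update (Function.update T src []) src' [] :=
        Function.update_eq_self_iff.2 (by simp [h₁.symm, h₂.symm])
      simp [equalities, hs, hs', hdst, h.symm]
    | succ n ih =>
      intro T f l l' hl hs hs' hn
      have hfin : ∀ (m m' : List (List Bool)) (y : List Symb) (f' : Bool),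
          m.length = m'.length → (tupleCode m).length + (tupleCode m').length ≤ n →
          ((equalities m m').modifyHead (Option.map (f' && ·))).reverse ++ y =
            ((equalities l l').modifyHead (Option.map (f && ·))).reverse ++ T dst →
          (compareEach M src src' dst).Runs
            ((⟨none, none, none, none, fun _ => f'⟩, idleState M),
              allStacks (Function.update (Function.update (Function.update T src (tupleCode m))
                src' (tupleCode m')) dst y) (idleStacks M))
            (idle M (Function.update (Function.update (Function.update T src []) src' [])
              dst (((equalities l l').modifyHead (Option.map (f && ·))).reverse ++ T dst)))
            (n + 1) := by
        intro m m' y f' hm hmn hy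
        refine (ih _ f' m m' hm (by simp [h, h₁]) (by simp [h₂]) hmn).of_eq
          (congrArg (idle M) ?_)
        rw [Function.update_self, hy]
        funext k
        by_cases h₃ : k = dst <;> by_cases h₄ : k = src <;> by_cases h₅ : k = src' <;>
            simp_all
      have hdst : ∀ x y : List Symb,
          Function.update (Function.update (Function.update T src x) src' y) dst (T dst) =
            Function.update (Function.update T src x) src' y :=
        fun x y => Function.update_eq_self_iff.2 (by simp [h₁.symm, h₂.symm])
      rcases l with _ | ⟨_ | ⟨b, s⟩, l⟩ <;> rcases l' with _ | ⟨_ | ⟨b', s'⟩, l'⟩ <;>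
        simp only [List.length_nil, List.length_cons, Nat.add_right_cancel_iff] at hl
      · refine Prog.Runs.mono (t := 1) (Prog.runs_ofStmt_halt ?_) (by omega)
        simp [equalities, hs, hs', hdst, h.symm]
      · omega
      · omega
      · omega
      · refine Prog.runs_ofStmt_goto ?_ (hfin l l' (some f :: T dst) true hl ?_ ?_)
        · simp [hs, hs', h.symm, h₁.symm, h₂.symm, Regs.init]
        · simp at hn; omega
        · rcases l with _ | ⟨s, l⟩ <;> rcases l' with _ | ⟨s', l'⟩ <;> simp [equalities]
      -- The pushed-back marker keeps `[]` at the head of the first tuple, while the second loses a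
      -- bit; the total length still drops.
      · refine Prog.runs_ofStmt_goto ?_ (hfin ([] :: l) (s' :: l') (T dst) false (by simpa) ?_ ?_)
        · have hc : ∀ x y z, Function.update (Function.update (Function.update T src x) src' y) src z
              = Function.update (Function.update T src z) src' y := by
            intro x y z
            rw [Function.update_comm h.symm, Function.update_idem]
          simp [hs, hs', hdst, h, h.symm, Regs.init, hc]
        · simp at hn ⊢; omega
        · simp [equalities]
      · omega
      · refine Prog.runs_ofStmt_goto ?_ (hfin (s :: l) ([] :: l') (T dst) false (by simpa) ?_ ?_)
        · simp [hs, hs', hdst, h, h.symm, Regs.init]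
        · simp at hn ⊢; omega
        · simp [equalities]
      · refine Prog.runs_ofStmt_goto ?_
          (hfin (s :: l) (s' :: l') (T dst) (f && b == b') (by simpa) ?_ ?_)
        · simp [hs, hs', hdst, h.symm, Regs.init]
        · simp at hn ⊢; omega
        · by_cases hb : b = b' <;> simp [equalities, hb]
  refine (key _ T true l l' hl hs hs' le_rfl).mono ?_ |>.of_eq ?_
  · rw [hs, hs']
  · have : (fun x : Bool => true && x) = id := by funext x; simp
    rcases equalities l l' with _ | ⟨s, y⟩ <;> simp

end Gadgets

/-! ### Polynomial time bounds for programs -/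

section PolyBounded

variable {α : Type}

/-- On `D`, the function `f` is bounded by a polynomial in the size `sz`. -/
def PolyBounded (D : Set α) (sz f : α → ℕ) : Prop :=
  ∃ p : Polynomial ℕ, ∀ a ∈ D, f a ≤ p.eval (sz a)

/-- Natural coefficients make every polynomial monotone, so a polynomial in a bounded quantity can
be bounded by composition. -/
theorem eval_mono (p : Polynomial ℕ) {m n : ℕ} (h : m ≤ n) : p.eval m ≤ p.eval n := by
  induction p using Polynomial.induction_on' with
  | add p q hp hq => simpa using add_le_add hp hq
  | monomial k c => simpa using Nat.mul_le_mul_left c (Nat.pow_le_pow_left h k)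

namespace PolyBounded

variable {D D' : Set α} {sz f g : α → ℕ}

theorem const (c : ℕ) : PolyBounded D sz fun _ => c := ⟨.C c, by simp⟩

theorem size : PolyBounded D sz sz := ⟨.X, by simp⟩

theorem add (hf : PolyBounded D sz f) (hg : PolyBounded D sz g) :
    PolyBounded D sz fun a => f a + g a := by
  obtain ⟨p, hp⟩ := hf
  obtain ⟨q, hq⟩ := hg
  exact ⟨p + q, fun a ha => by simpa using add_le_add (hp a ha) (hq a ha)⟩

theorem mul_const (hf : PolyBounded D sz f) (c : ℕ) : PolyBounded D sz fun a => f a * c := by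
  obtain ⟨p, hp⟩ := hf
  exact ⟨p * .C c, fun a ha => by simpa using Nat.mul_le_mul_right c (hp a ha)⟩

theorem mono (hg : PolyBounded D sz g) (h : ∀ a ∈ D, f a ≤ g a) : PolyBounded D sz f := by
  obtain ⟨p, hp⟩ := hg
  exact ⟨p, fun a ha => (h a ha).trans (hp a ha)⟩

theorem subset (hf : PolyBounded D sz f) (h : D' ⊆ D) : PolyBounded D' sz f := by
  obtain ⟨p, hp⟩ := hf
  exact ⟨p, fun a ha => hp a (h ha)⟩

theorem eval (hf : PolyBounded D sz f) (q : Polynomial ℕ) :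
    PolyBounded D sz fun a => q.eval (f a) := by
  obtain ⟨p, hp⟩ := hf
  exact ⟨q.comp p, fun a ha => by
    rw [Polynomial.eval_comp]
    exact eval_mono q (hp a ha)⟩

end PolyBounded

variable {L J : Type} {M : J → Subroutine Symb} [DecidableEq L] [DecidableEq J]

/-- For `a ∈ D`, the program `P` transforms `T a` into `T' a` in polynomial time. -/
def PolyRuns (D : Set α) (sz : α → ℕ) (P : Program M L) (T T' : α → L → List Symb) : Prop :=
  ∃ t, PolyBounded D sz t ∧ ∀ a ∈ D, P.Runs (idle M (T a)) (idle M (T' a)) (t a)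

/-- For `a ∈ D`, the subroutine `S` transforms `x a` into `y a` in polynomial time. -/
def PolyOutputs (D : Set α) (sz : α → ℕ) (S : Subroutine Symb) (x y : α → List Symb) : Prop :=
  ∃ t, PolyBounded D sz t ∧ ∀ a ∈ D, S.Outputs (x a) (y a) (t a)

variable {D : Set α} {sz : α → ℕ} {T T' T'' : α → L → List Symb}

/-- Needed because the output of one subroutine is processed further, and the cost of that depends
on its length. -/
theorem PolyOutputs.polyBounded {S : Subroutine Symb} {x y : α → List Symb}
    (h : PolyOutputs D sz S x y) (hx : PolyBounded D sz fun a => (x a).length) :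
    PolyBounded D sz fun a => (y a).length := by
  obtain ⟨t, ht, h⟩ := h
  obtain ⟨C, hC⟩ := S.exists_length_le
  exact (hx.add (ht.mul_const C)).mono fun a ha => hC _ _ _ (h a ha)

namespace PolyRuns

theorem seq {P Q : Program M L} (h : PolyRuns D sz P T T') (h' : PolyRuns D sz Q T' T'') :
    PolyRuns D sz (P.seq Q) T T'' := by
  obtain ⟨t, ht, h⟩ := h
  obtain ⟨t', ht', h'⟩ := h'
  exact ⟨_, ht.add ht', fun a ha => (h a ha).seq (h' a ha)⟩

theorem congr {P : Program M L} (h : PolyRuns D sz P T T') (hT : ∀ a ∈ D, T' a = T'' a) :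
    PolyRuns D sz P T T'' := by
  obtain ⟨t, ht, h⟩ := h
  exact ⟨t, ht, fun a ha => hT a ha ▸ h a ha⟩

theorem move {src dst : L} (h : src ≠ dst) (hb : PolyBounded D sz fun a => (T a src).length) :
    PolyRuns D sz (move M src dst) T fun a =>
      Function.update (Function.update (T a) src []) dst ((T a src).reverse ++ T a dst) :=
  ⟨_, hb.add (.const 1), fun a _ => runs_move h (T a)⟩

theorem clear {src : L} (hb : PolyBounded D sz fun a => (T a src).length) :
    PolyRuns D sz (clear M src) T fun a => Function.update (T a) src [] :=
  ⟨_, hb.add (.const 1), fun a _ => runs_clear (T a)⟩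

theorem pushSymb (dst : L) (s : Symb) :
    PolyRuns D sz (pushSymb M dst s) T fun a => Function.update (T a) dst (s :: T a dst) :=
  ⟨_, .const 1, fun a _ => runs_pushSymb s (T a)⟩

theorem takeString {src dst : L} (h : src ≠ dst) {x : α → List Bool} {y : α → List Symb}
    (hx : ∀ a ∈ D, T a src = (x a).map some ++ none :: y a)
    (hb : PolyBounded D sz fun a => (x a).length) :
    PolyRuns D sz (takeString M src dst) T fun a =>
      Function.update (Function.update (T a) src (y a)) dst
        (((x a).map some).reverse ++ T a dst) :=
  ⟨_, hb.add (.const 1), fun a ha => runs_takeString h (T a) (x a) (y a) (hx a ha)⟩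

theorem compare {src src' dst : L} (h : src ≠ src') (h₁ : src ≠ dst) (h₂ : src' ≠ dst)
    (hb : PolyBounded D sz fun a => (T a src).length)
    (hb' : PolyBounded D sz fun a => (T a src').length) :
    PolyRuns D sz (compare M src src' dst) T fun a =>
      Function.update (Function.update (Function.update (T a) src []) src' [])
        dst (some (decide (T a src = T a src')) :: T a dst) :=
  ⟨_, (hb.add hb').add (.const 1), fun a _ => runs_compare h h₁ h₂ (T a)⟩

theorem decode {src dst : L} (h : src ≠ dst)
    (hb : PolyBounded D sz fun a => (T a src).length) :
    PolyRuns D sz (decode M src dst) T fun a =>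
      Function.update (Function.update (T a) src (decodeFrom (T a src) (T a dst)).2)
        dst (decodeFrom (T a src) (T a dst)).1 :=
  ⟨_, hb.add (.const 1), fun a _ => runs_decode h (T a)⟩

theorem compareEach {src src' dst : L} (h : src ≠ src') (h₁ : src ≠ dst) (h₂ : src' ≠ dst)
    {l l' : α → List (List Bool)} (hl : ∀ a ∈ D, (l a).length = (l' a).length)
    (hs : ∀ a ∈ D, T a src = tupleCode (l a)) (hs' : ∀ a ∈ D, T a src' = tupleCode (l' a))
    (hb : PolyBounded D sz fun a => (T a src).length)
    (hb' : PolyBounded D sz fun a => (T a src').length) :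
    PolyRuns D sz (compareEach M src src' dst) T fun a =>
      Function.update (Function.update (Function.update (T a) src []) src' [])
        dst ((equalities (l a) (l' a)).reverse ++ T a dst) :=
  ⟨_, (hb.add hb').add (.const 1),
    fun a ha => runs_compareEach h h₁ h₂ (T a) (hl a ha) (hs a ha) (hs' a ha)⟩

theorem call {j : J} {src dst : L} (h : src ≠ dst) {x y : α → List Symb}
    (hx : ∀ a ∈ D, T a src = (x a).reverse) (hy : PolyOutputs D sz (M j) x y)
    (hb : PolyBounded D sz fun a => (x a).length) :
    PolyRuns D sz (call M j src dst) T fun a =>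
      Function.update (Function.update (T a) src []) dst ((y a).reverse ++ T a dst) := by
  have hb' := hy.polyBounded hb
  obtain ⟨t, ht, hy⟩ := hy
  exact ⟨_, ((hb.add ht).add hb').add (.const 2), fun a ha => runs_call h (T a) (hx a ha) (hy a ha)⟩

/-- Each branch has to be analysed only on the inputs that reach it. This lets a subroutine be used
under a condition that was tested before. -/
theorem ifPop {k : L} {P Q : Program M L} {x : α → List Symb} {c : α → Bool}
    (hk : ∀ a ∈ D, T a k = some (c a) :: x a)
    (hP : PolyRuns {a ∈ D | c a = true} sz P (fun a => Function.update (T a) k (x a)) T')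
    (hQ : PolyRuns {a ∈ D | c a = false} sz Q (fun a => Function.update (T a) k (x a)) T') :
    PolyRuns D sz (ifPop k P Q) T T' := by
  obtain ⟨t, ⟨p, hp⟩, hP⟩ := hP
  obtain ⟨t', ⟨p', hp'⟩, hQ⟩ := hQ
  -- The times `t` and `t'` are controlled only on their own branch, so the bound uses the
  -- polynomials themselves; the constant 1 is the branching step.
  refine ⟨fun a => (p + p' + .C 1).eval (sz a), ⟨_, fun a _ => le_rfl⟩, fun a ha => ?_⟩
  have hk := hk a ha
  cases hc : c a with
  | true =>
    rw [hc] at hk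
    refine (runs_ifPop_true hk (hP a ⟨ha, hc⟩)).mono ?_
    have := hp a ⟨ha, hc⟩
    simp only [Polynomial.eval_add, Polynomial.eval_C]
    omega
  | false =>
    rw [hc] at hk
    refine (runs_ifPop_false hk (hQ a ⟨ha, hc⟩)).mono ?_
    have := hp' a ⟨ha, hc⟩
    simp only [Polynomial.eval_add, Polynomial.eval_C]
    omega

end PolyRuns

/-- Copy the contents of `src` to `dst`, in reverse order, with the help of the empty stack `t`. -/
def copy (M : J → Subroutine Symb) (src dst t : L) : Program M L :=
  (moveBoth M src dst t).seq (move M t src)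

theorem PolyRuns.copy {src dst t : L} (h : src ≠ dst) (h' : src ≠ t) (h'' : dst ≠ t)
    (ht : ∀ a ∈ D, T a t = []) (hb : PolyBounded D sz fun a => (T a src).length) :
    PolyRuns D sz (copy M src dst t) T fun a =>
      Function.update (T a) dst ((T a src).reverse ++ T a dst) := by
  have h₁ : PolyRuns D sz (moveBoth M src dst t) T fun a =>
      Function.update (Function.update (Function.update (T a) src [])
        dst ((T a src).reverse ++ T a dst)) t ((T a src).reverse ++ T a t) :=
    ⟨_, hb.add (.const 1), fun a _ => runs_moveBoth h h' h'' (T a)⟩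
  have h₂ := h₁.seq (.move (M := M) (src := t) (dst := src) h'.symm (hb.mono fun a ha => by
    simp [ht a ha]))
  refine h₂.congr fun a ha => ?_
  have := ht a ha
  funext k
  by_cases hk₁ : k = src <;> by_cases hk₂ : k = dst <;> by_cases hk₃ : k = t <;> simp_all

/-- Empty all the stacks in a list. -/
def clearAll (M : J → Subroutine Symb) : List L → Program M L
  | [] => .ofStmt .halt
  | k :: ks => (clear M k).seq (clearAll M ks)

theorem PolyRuns.clearAll (ks : List L)
    (hb : ∀ k ∈ ks, PolyBounded D sz fun a => (T a k).length) :
    PolyRuns D sz (clearAll M ks) T fun a k => if k ∈ ks then [] else T a k := by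
  induction ks generalizing T with
  | nil => exact ⟨_, .const 1, fun a _ => Prog.runs_ofStmt_halt (by simp)⟩
  | cons k ks ih =>
    refine ((PolyRuns.clear (M := M) (hb k (by simp))).seq (ih ?_)).congr ?_
    · intro k' hk'
      refine (hb k' (by simp [hk'])).mono fun a _ => ?_
      by_cases h : k' = k
      · subst h; simp
      · simp [h]
    · intro a _
      funext k'
      by_cases h : k' = k <;> by_cases h' : k' ∈ ks <;> simp_all

/-- Write the truth value on `res` to the output stack of the machine `M j`. -/
def output (M : J → Subroutine Symb) (j : J) (f : Bool → (M j).tm.Γ (M j).tm.k₁) (res : L) :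
    Program M L :=
  .ofStmt <| popA res <|
    .push (.inr ⟨j, (M j).tm.k₁⟩) (fun s => f (s.1.a == some (some true))) <| reset .halt

/-- A predicate that is computed by a program is decidable in polynomial time. The machine `M j`
provides an output stack with the right alphabet. -/
theorem polyTimeDecidable_of_polyRuns [Fintype L] [Fintype J] (ea : α → List Symb) (j : J)
    (e : (M j).tm.Γ (M j).tm.k₁ ≃ Bool) (P : Program M L) (inp res : L) (f : α → Bool)
    (h : PolyRuns Set.univ (fun a => (ea a).length) P
      (fun a => Function.update (fun _ => []) inp (ea a))
      (fun a => Function.update (fun _ => []) res [some (f a)])) :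
    PolyTimeDecidable ea (fun a => f a = true) := by
  obtain ⟨t, ⟨p, hp⟩, h⟩ := h
  refine ⟨f, fun _ => Iff.rfl, ?_⟩
  let Q := P.seq (output M j e.symm res)
  have : ∀ j, Fintype (M j).tm.K := fun j => (M j).tm.kFin
  have : ∀ j, Fintype (M j).tm.σ := fun j => (M j).tm.σFin
  have := Q.fin
  let tm : FinTM2 :=
    { K := StackIndex L M
      k₀ := .inl inp
      k₁ := .inr ⟨j, (M j).tm.k₁⟩
      Γ := Alphabet L M
      Λ := Q.Λ
      main := Q.main
      σ := MachineState Regs M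
      initialState := (.init, idleState M)
      Γk₀Fin := inferInstanceAs (Fintype Symb)
      m := Q.m }
  -- The program's own stacks carry three symbols, whereas the answer must be over an alphabet
  -- equivalent to `Bool`; hence the borrowed output stack. The extra step is the one that writes
  -- the answer there.
  refine ⟨⟨⟨tm, Equiv.refl _, e⟩, p + .C 1, fun a => Classical.choice ?_⟩⟩
  rw [nonempty_outputsInTime_iff]
  have h₁ := (h a trivial).mono (hp a trivial)
  have h₂ : (output M j e.symm res).Runs
      (idle M (Function.update (fun _ => []) res [some (f a)]))
      ((.init, idleState M), allStacks (fun _ => []) (Function.update (idleStacks M) j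
        (Function.update (idleStacks M j) (M j).tm.k₁ [e.symm (f a)]))) 1 := by
    apply Prog.runs_ofStmt_halt
    cases hf : f a <;> simp [idle, popA, reset]
  have h₃ := h₁.seq h₂
  have hi : (Function.update (fun _ => []) (Sum.inl inp) ((ea a).map id) :
      ∀ k, List (Alphabet L M k)) =
        allStacks (Function.update (fun _ => []) inp (ea a)) (idleStacks M) := by
    rw [← update_allStacks_inl, List.map_id]
    congr 1
    funext k
    rcases k with k | k <;> rfl
  have ho : (Function.update (fun _ => []) (Sum.inr ⟨j, (M j).tm.k₁⟩) [e.symm (f a)] :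
      ∀ k, List (Alphabet L M k)) =
        allStacks (fun _ => []) (Function.update (idleStacks M) j
          (Function.update (idleStacks M j) (M j).tm.k₁ [e.symm (f a)])) := by
    rw [← update_allStacks_inr]
    congr 1
    funext k
    rcases k with k | k <;> rfl
  obtain ⟨n, hn, h₄⟩ := h₃
  refine ⟨n, by simpa using hn, ?_⟩
  change StepsIn Q.m n ⟨_, _, Function.update (fun _ => []) (Sum.inl inp) ((ea a).map id)⟩
    ⟨_, _, Function.update (fun _ => []) (Sum.inr ⟨j, (M j).tm.k₁⟩) [e.symm (f a)]⟩
  rw [hi, ho]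
  exact h₄

/-- The machine of a polynomial-time computable function, as a subroutine. -/
def Subroutine.ofComputable {β Γ Δ : Type} {ea : α → List Γ} {eb : β → List Δ} {f : α → β}
    (h : TM2ComputableInPolyTime ea eb f) (read : Symb → Γ) (write : Δ → Symb) :
    Subroutine Symb where
  tm := h.tm
  read s := h.inputAlphabet.symm (read s)
  write s := write (h.outputAlphabet s)

theorem Subroutine.outputs_ofComputable {β Γ Δ : Type} {ea : α → List Γ} {eb : β → List Δ}
    {f : α → β} (h : TM2ComputableInPolyTime ea eb f) (read : Symb → Γ) (write : Δ → Symb)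
    {x : List Symb} {a : α} (hx : x.map read = ea a) :
    (Subroutine.ofComputable h read write).Outputs x ((eb (f a)).map write)
      (h.time.eval x.length) := by
  refine ⟨(eb (f a)).map h.outputAlphabet.symm, ⟨?_⟩, ?_⟩
  · have := h.outputsFun a
    rw [← hx, List.length_map, List.map_map] at this
    exact this
  · change _ = ((eb (f a)).map h.outputAlphabet.symm).map fun s => write (h.outputAlphabet s)
    simp [Function.comp_def]

end PolyBounded

/-! ### Stacks of the verifier and evaluation of the matrix -/

/-- The stacks of the program that verifies disentangledness. -/
inductive Stk
  | inp | w | u | v | x | y | z | q | t | t' | a | b | pb | exy | exz | kxy | kxz | res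
  deriving DecidableEq

instance : Fintype Stk where
  elems := {.inp, .w, .u, .v, .x, .y, .z, .q, .t, .t', .a, .b, .pb, .exy, .exz, .kxy, .kxz, .res}
  complete k := by cases k <;> simp

/-- The subroutines: recognize well-formed inputs, compute the partition, test feasibility,
classify. -/
inductive Sub
  | wf | part | feas | cls
  deriving DecidableEq

instance : Fintype Sub where
  elems := {.wf, .part, .feas, .cls}
  complete k := by cases k <;> simp

/-- The symbol is the bit `true`. -/
def isOne (s : Option Symb) : Bool := s == some (some true)

/-- The tests that are made at each feature, given the truth of `y_i = x_i` and `z_i = x_i`, and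
the membership of `i` in `P` and `Q`. -/
def featureTest (i : Fin 5) (exy exz p q : Option Symb) : Bool :=
  ![isOne p || isOne exy, !isOne q || isOne exy, isOne p || isOne exz, !isOne q || isOne exz,
    !(isOne p && isOne q)] i

/-- The truth value of the condition for disentangledness. -/
def verdict (f : Fin 5 → Bool) (kxy kxz : Bool) : Bool :=
  (!f 0 || kxy) && (f 4 || (f 3 && !kxz) || (!f 1 || f 0) || (f 2 && !f 3))

/-- The flags 0 to 4 stand for `y_N = x_N`, `y_Q = x_Q`, `z_N = x_N`, `z_Q = x_Q` and `Q ∩ P = ∅`;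
`kxy` and `kxz` stand for `κ(y) = κ(x)` and `κ(z) = κ(x)`. -/
theorem verdict_eq_true_iff (f : Fin 5 → Bool) (kxy kxz : Bool) :
    verdict f kxy kxz = true ↔ (¬ f 0 = true ∨ kxy = true) ∧
      (f 4 = true ∨ (f 3 = true ∧ ¬ kxz = true) ∨ (¬ f 1 = true ∨ f 0 = true) ∨
        (f 2 = true ∧ ¬ f 3 = true)) := by
  simp only [verdict, Bool.and_eq_true, Bool.or_eq_true, Bool.not_eq_true', Bool.not_eq_true,
    or_assoc]

variable {M : Sub → Subroutine Symb}

/-- Evaluate the condition for disentangledness, and push the result to the stack `res`. -/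
def evaluate (M : Sub → Subroutine Symb) : Program M Stk :=
  .ofStmt <| popA .exy <| popB .exz <| popC .pb <| popD .q <|
    ifR (fun r => r.c.isSome)
      (mapR (fun r => { Regs.init with
        flag := fun i => r.flag i && featureTest i r.a r.b r.c r.d }) again)
      (popA .kxy <| popB .kxz <|
        pushR .res (fun r => some (verdict r.flag (isOne r.a) (isOne r.b))) <| reset .halt)

/-- The flags at the end of `evaluate`. -/
def finalFlags (exy exz pb q : List Symb) (i : Fin 5) : Bool :=
  decide (∀ j < pb.length, featureTest i exy[j]? exz[j]? pb[j]? q[j]? = true)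

theorem finalFlags_cons (exy exz : List Symb) (p : Symb) (pb q : List Symb) (i : Fin 5) :
    finalFlags exy exz (p :: pb) q i = (featureTest i exy.head? exz.head? (some p) q.head? &&
      finalFlags exy.tail exz.tail pb q.tail i) := by
  rw [Bool.eq_iff_iff]
  simp only [finalFlags, decide_eq_true_eq, Bool.and_eq_true, List.length_cons,
    List.getElem?_tail, List.head?_eq_getElem?]
  constructor
  · intro h
    exact ⟨h 0 (by omega), fun j hj => h (j + 1) (by omega)⟩
  · rintro ⟨h, h'⟩ (_ | j) hj
    · exact h
    · exact h' j (by omega)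

/-- The stack `pb` has one bit per feature and controls the loop. If `q` is too short, a missing
symbol counts as non-membership. Of the other stacks only the lengths matter, because they are
cleared afterwards. -/
theorem runs_evaluate (T : Stk → List Symb) :
    ∃ T', (evaluate M).Runs (idle M T) (idle M T') ((T .pb).length + 1) ∧
      T' .res = some (verdict (finalFlags (T .exy) (T .exz) (T .pb) (T .q))
        (isOne (T .kxy).head?) (isOne (T .kxz).head?)) :: T .res ∧
      ∀ k, k ≠ .res → (T' k).length ≤ (T k).length := by
  have key : ∀ (pb : List Symb) (T : Stk → List Symb) (f : Fin 5 → Bool), T .pb = pb →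
      ∃ T', (evaluate M).Runs
      ((⟨none, none, none, none, f⟩, idleState M), allStacks T (idleStacks M)) (idle M T')
      (pb.length + 1) ∧
      T' .res = some (verdict (fun i => f i && finalFlags (T .exy) (T .exz) pb (T .q) i)
        (isOne (T .kxy).head?) (isOne (T .kxz).head?)) :: T .res ∧
      ∀ k, k ≠ .res → (T' k).length ≤ (T k).length := by
    intro pb
    induction pb with
    | nil =>
      intro T f hT
      -- The round that finds `pb` empty has already popped from `exy`, `exz` and `q`.
      let T₁ := Function.update (Function.update (Function.update (Function.update
        (Function.update T .exy (T .exy).tail) .exz (T .exz).tail) .q (T .q).tail)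
        .kxy (T .kxy).tail) .kxz (T .kxz).tail
      have hpb : Function.update (Function.update (Function.update T .exy (T .exy).tail)
          .exz (T .exz).tail) .pb [] =
          Function.update (Function.update T .exy (T .exy).tail) .exz (T .exz).tail :=
        Function.update_eq_self_iff.2 (by simp [hT])
      refine ⟨Function.update T₁ .res (some (verdict f (isOne (T .kxy).head?)
        (isOne (T .kxz).head?)) :: T .res), Prog.runs_ofStmt_halt ?_, ?_, ?_⟩
      · simp [popA, popB, popC, popD, ifR, pushR, reset, hT, hpb, idle, T₁]
      · simp [finalFlags]
      · intro k hk
        rw [Function.update_of_ne hk]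
        simp only [T₁]
        simp only [Function.update_apply]
        split_ifs <;> simp_all
    | cons p pb ih =>
      intro T f hT
      obtain ⟨T', h₁, h₂, h₃⟩ := ih
        (Function.update (Function.update (Function.update (Function.update T .exy (T .exy).tail)
          .exz (T .exz).tail) .pb pb) .q (T .q).tail)
        (fun i => f i && featureTest i (T .exy).head? (T .exz).head? (some p) (T .q).head?)
        (by simp)
      refine ⟨T', Prog.runs_ofStmt_goto ?_ h₁, ?_, fun k hk => (h₃ k hk).trans ?_⟩
      · simp [popA, popB, popC, popD, ifR, mapR, again, hT, Regs.init]
      · rw [h₂]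
        simp [finalFlags_cons, Bool.and_assoc]
      · simp only [Function.update_apply]
        split_ifs <;> simp_all
  simpa [idle, Regs.init] using key _ T (fun _ => true) rfl

/-! ### Decoding tuples of strings -/

/-- The effect of pushing a symbol on the tuple whose code is on a stack. -/
def pushInto : Symb → List (List Bool) → List (List Bool)
  | _, [] => []
  | none, s :: l => [] :: s :: l
  | some b, s :: l => (b :: s) :: l

/-- Decode a tuple of strings, starting from the tuple `l`; return also the part of `x` that is
left over. -/
def decodeStrings : List Symb → List (List Bool) → List (List Bool) × List Symb
  | s :: s' :: x, l =>
    if s = some true then decodeStrings x (pushInto s' l)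
    else if s' = some true then decodeStrings x ([] :: l)
    else (l, x)
  | _, l => (l, [])

theorem tupleCode_eq_nil {l : List (List Bool)} : tupleCode l = [] ↔ l = [] := by
  rcases l with _ | ⟨_ | ⟨b, s⟩, l⟩ <;> simp

theorem length_le_length_tupleCode (l : List (List Bool)) : l.length ≤ (tupleCode l).length := by
  induction l with
  | nil => simp
  | cons s l ih => simp [tupleCode_cons]; omega

theorem tupleCode_pushInto (s : Symb) (l : List (List Bool)) :
    tupleCode (pushInto s l) = if tupleCode l = [] then [] else s :: tupleCode l := by
  rcases l with _ | ⟨s', l⟩ <;> rcases s with _ | b <;>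
    simp [pushInto, tupleCode_eq_nil]

/-- Dropping data symbols on an empty stack guarantees that whatever is decoded is the code of a
tuple. Arbitrary `u` and `v` thus lead to arguments on which the feasibility test is specified. -/
theorem decodeFrom_tupleCode (x : List Symb) (l : List (List Bool)) :
    decodeFrom x (tupleCode l) = (tupleCode (decodeStrings x l).1, (decodeStrings x l).2) := by
  induction x, l using decodeStrings.induct with
  | case1 s' x l ih => simp [decodeFrom, decodeStrings, ← ih, tupleCode_pushInto]
  | case2 s x l hs ih => simp [decodeFrom, decodeStrings, ← ih, hs]
  | case3 s s' x l hs hs' => simp [decodeFrom, decodeStrings, hs, hs']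
  | case4 x l h =>
    rcases x with _ | ⟨s, _ | ⟨s', x⟩⟩
    · simp [decodeFrom, decodeStrings]
    · simp [decodeFrom, decodeStrings]
    · exact (h _ _ _ rfl).elim

/-- Two symbols are consumed for at most one that is produced, so decoded tuples and remainders stay
within the size of the input. -/
theorem length_decodeStrings_le (x : List Symb) (l : List (List Bool)) :
    (tupleCode (decodeStrings x l).1).length + (decodeStrings x l).2.length ≤
      x.length + (tupleCode l).length := by
  induction x, l using decodeStrings.induct with
  | case1 s' x l ih =>
    have : (tupleCode (pushInto s' l)).length ≤ (tupleCode l).length + 1 := by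
      rw [tupleCode_pushInto]
      split_ifs <;> simp
    simp only [decodeStrings, if_true, List.length_cons]
    omega
  | case2 s x l hs ih =>
    simp only [tupleCode_nil_cons, List.length_cons] at ih
    simp only [decodeStrings, hs, if_true, if_false, List.length_cons]
    omega
  | case3 s s' x l hs hs' => simp [decodeStrings, hs, hs']; omega
  | case4 x l h =>
    rcases x with _ | ⟨s, _ | ⟨s', x⟩⟩
    · simp [decodeStrings]
    · simp [decodeStrings]
    · exact (h _ _ _ rfl).elim

/-- The bits that `decodeStrings` decodes to the given symbols. -/
def symbBits (r : List Symb) : List Bool :=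
  r.flatMap fun s => s.elim [false, true] fun b => [true, b]

theorem length_symbBits (r : List Symb) : (symbBits r).length = 2 * r.length := by
  induction r with
  | nil => rfl
  | cons s r ih => rcases s with _ | b <;> simp_all [symbBits] <;> omega

theorem decodeStrings_symbBits_string (s t : List Bool) (l : List (List Bool)) (x : List Symb) :
    decodeStrings ((symbBits (s.map some)).map some ++ x) (t :: l) =
      decodeStrings x ((s.reverse ++ t) :: l) := by
  induction s generalizing t with
  | nil => simp [symbBits]
  | cons b s ih =>
    have := ih (b :: t)
    simp_all [symbBits, decodeStrings, pushInto]

/-- Decoding pushes symbols, so the code of a tuple has to be presented from its last symbol to its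
first. The arbitrary continuation `x` allows several tuples to be decoded from one string. -/
theorem decodeStrings_symbBits (l : List (List Bool)) (x : List Symb) :
    decodeStrings ((symbBits (tupleCode l).reverse).map some ++ x) [] = decodeStrings x l := by
  induction l generalizing x with
  | nil => rfl
  | cons s l ih =>
    have h : symbBits (tupleCode (s :: l)).reverse =
        symbBits (tupleCode l).reverse ++ (false :: true :: symbBits (s.reverse.map some)) := by
      simp [tupleCode_cons, symbBits]
    rw [h, List.map_append, List.append_assoc, ih]
    have := decodeStrings_symbBits_string s.reverse [] l x
    simp_all [decodeStrings]

/-! ### The program -/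

variable {M : Sub → Subroutine Symb} {α : Type} {D : Set α} {sz : α → ℕ}
  {T T' : α → Stk → List Symb}

/-- Call the subroutine `j` with the string on `w`, and move the result to `dst`. -/
def callString (M : Sub → Subroutine Symb) (j : Sub) (dst : Stk) : Program M Stk :=
  (copy M .w .t .t').seq (call M j .t dst)

/-- Call the subroutine `j` with the string on `w` and the tuple on `src`, and move the result
to `dst`. -/
def callTuple (M : Sub → Subroutine Symb) (j : Sub) (src dst : Stk) : Program M Stk :=
  (copy M .w .t .t').seq <| (pushSymb M .t none).seq <| (copy M src .t .t').seq <| call M j .t dst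

/-- Push to `dst` whether the tuples on `src` and `src'` belong to the same class. -/
def compareClasses (M : Sub → Subroutine Symb) (src src' dst : Stk) : Program M Stk :=
  (callTuple M .cls src .a).seq <| (callTuple M .cls src' .b).seq <| compare M .a .b dst

/-- Compare the entries of the tuples on `x` and `src`, and push the results to `dst`. -/
def compareWithX (M : Sub → Subroutine Symb) (src dst : Stk) : Program M Stk :=
  (copy M .x .t .t').seq <| (move M .t .a).seq <| compareEach M .a src dst

/-- Clear all stacks except `res`. -/
def cleanUp (M : Sub → Subroutine Symb) : Program M Stk :=
  clearAll M [.inp, .w, .u, .v, .x, .y, .z, .q, .t, .t', .a, .b, .pb, .exy, .exz, .kxy, .kxz]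

/-- Leave only the truth value `c`, on the stack `res`. -/
def answer (M : Sub → Subroutine Symb) (c : Bool) : Program M Stk :=
  (pushSymb M .res (some c)).seq (cleanUp M)

/-- The part of the program after the feasibility tests. -/
def evaluation (M : Sub → Subroutine Symb) : Program M Stk :=
  (compareClasses M .x .y .kxy).seq <| (compareClasses M .x .z .kxz).seq <|
    (compareWithX M .y .exy).seq <| (compareWithX M .z .exz).seq <|
    (callString M .part .pb).seq <| (evaluate M).seq (cleanUp M)

/-- The part of the program after the test whether the input is well-formed. -/
def verification (M : Sub → Subroutine Symb) : Program M Stk :=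
  (decode M .u .x).seq <| (decode M .u .y).seq <| (decode M .u .q).seq <| (decode M .v .z).seq <|
    (callTuple M .feas .x .res).seq <| ifPop .res
      ((callTuple M .feas .y .res).seq <| ifPop .res
        ((callTuple M .feas .z .res).seq <| ifPop .res (evaluation M) (answer M false))
        (answer M true))
      (answer M true)

/-- Read the three strings of the input. -/
def readInput (M : Sub → Subroutine Symb) : Program M Stk :=
  (takeString M .inp .t).seq <| (move M .t .w).seq <| (takeString M .inp .u).seq <|
    takeString M .inp .v

/-- The program that verifies disentangledness. -/
def verifier (M : Sub → Subroutine Symb) : Program M Stk :=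
  (readInput M).seq <| (callString M .wf .res).seq <| ifPop .res (verification M) (answer M false)

theorem PolyRuns.callString {j : Sub} {dst : Stk} (hd : .t ≠ dst)
    {y : α → List Symb} (ht : ∀ a ∈ D, T a .t = []) (ht' : ∀ a ∈ D, T a .t' = [])
    (hy : PolyOutputs D sz (M j) (fun a => T a .w) y)
    (hw : PolyBounded D sz fun a => (T a .w).length) :
    PolyRuns D sz (callString M j dst) T fun a =>
      Function.update (T a) dst ((y a).reverse ++ T a dst) := by
  refine ((PolyRuns.copy (by simp) (by simp) (by simp) ht' hw).seq
    (PolyRuns.call hd (fun a ha => ?_) hy hw)).congr fun a ha => ?_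
  · simp [ht a ha]
  · have := ht a ha
    funext k
    by_cases h : k = dst <;> by_cases h₁ : k = .t <;> simp_all

/-- The two copies around the marker leave the reverse of `w`, marker, `src` on `t`, which `call`
turns back into the code of the tuple with `w` in front. -/
theorem PolyRuns.callTuple {j : Sub} {src dst : Stk} (hs : src ≠ .t) (hs' : src ≠ .t')
    (hd : .t ≠ dst)
    {y : α → List Symb} (ht : ∀ a ∈ D, T a .t = []) (ht' : ∀ a ∈ D, T a .t' = [])
    (hy : PolyOutputs D sz (M j) (fun a => T a .w ++ none :: T a src) y)
    (hw : PolyBounded D sz fun a => (T a .w).length)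
    (hb : PolyBounded D sz fun a => (T a src).length) :
    PolyRuns D sz (callTuple M j src dst) T fun a =>
      Function.update (T a) dst ((y a).reverse ++ T a dst) := by
  refine ((PolyRuns.copy (by simp) (by simp) (by simp) ht' hw).seq <|
    (PolyRuns.pushSymb _ _).seq <| (PolyRuns.copy hs hs' (by simp) (fun a ha => ?_) ?_).seq
    (PolyRuns.call hd (fun a ha => ?_) hy ?_)).congr fun a ha => ?_
  · simp [ht' a ha]
  · simpa [hs] using hb
  · simp [ht a ha, hs]
  · simpa using hw.add (hb.add (.const 1))
  · have := ht a ha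
    funext k
    by_cases h : k = dst <;> by_cases h₁ : k = .t <;> simp_all

theorem PolyRuns.compareClasses {src src' dst : Stk} (hs : src ∉ [Stk.t, .t', .a, .b])
    (hs' : src' ∉ [Stk.t, .t', .a, .b]) (hd : dst ∉ [Stk.t, .t', .a, .b])
    {y y' : α → List Symb} (ht : ∀ a ∈ D, ∀ k ∈ [Stk.t, .t', .a, .b], T a k = [])
    (hy : PolyOutputs D sz (M .cls) (fun a => T a .w ++ none :: T a src) y)
    (hy' : PolyOutputs D sz (M .cls) (fun a => T a .w ++ none :: T a src') y')
    (hw : PolyBounded D sz fun a => (T a .w).length)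
    (hb : PolyBounded D sz fun a => (T a src).length)
    (hb' : PolyBounded D sz fun a => (T a src').length) :
    PolyRuns D sz (compareClasses M src src' dst) T fun a =>
      Function.update (T a) dst (some (decide (y a = y' a)) :: T a dst) := by
  simp only [List.mem_cons, List.not_mem_nil, or_false, not_or] at hs hs' hd
  simp only [List.mem_cons, List.not_mem_nil, or_false, forall_eq_or_imp, forall_eq] at ht
  have hl := hy.polyBounded (by simpa using hw.add (hb.add (.const 1)))
  have hl' := hy'.polyBounded (by simpa using hw.add (hb'.add (.const 1)))
  refine ((PolyRuns.callTuple hs.1 hs.2.1 (by simp) (fun a ha => (ht a ha).1)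
    (fun a ha => (ht a ha).2.1) hy hw hb).seq <|
    (PolyRuns.callTuple (y := y') hs'.1 hs'.2.1 (by simp) ?_ ?_ ?_ ?_ ?_).seq <|
    PolyRuns.compare (by simp) (Ne.symm hd.2.2.1) (Ne.symm hd.2.2.2) ?_ ?_).congr fun a ha => ?_
  · simpa using fun a ha => (ht a ha).1
  · simpa using fun a ha => (ht a ha).2.1
  · simpa [hs'] using hy'
  · simpa using hw
  · simpa [hs'] using hb'
  · exact hl.mono fun a ha => by simp [ht a ha]
  · exact hl'.mono fun a ha => by simp [ht a ha]
  · have := ht a ha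
    funext k
    by_cases h : k = dst <;> by_cases h₁ : k = .a <;> by_cases h₂ : k = .b <;> simp_all

/-- `x` is compared through a copy and survives, but `src` is consumed. This is why `evaluation`
compares classes before it compares entries. -/
theorem PolyRuns.compareWithX {src dst : Stk} (hs : src ∉ [Stk.t, .t', .a, .x])
    (hd : dst ∉ [Stk.t, .t', .a]) (hsd : src ≠ dst) {l l' : α → List (List Bool)}
    (ht : ∀ a ∈ D, ∀ k ∈ [Stk.t, .t', .a], T a k = [])
    (hll : ∀ a ∈ D, (l a).length = (l' a).length)
    (hx : ∀ a ∈ D, T a .x = tupleCode (l a)) (hsrc : ∀ a ∈ D, T a src = tupleCode (l' a))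
    (hb : PolyBounded D sz fun a => (T a .x).length)
    (hb' : PolyBounded D sz fun a => (T a src).length) :
    PolyRuns D sz (compareWithX M src dst) T fun a =>
      Function.update (Function.update (T a) src []) dst
        ((equalities (l a) (l' a)).reverse ++ T a dst) := by
  simp only [List.mem_cons, List.not_mem_nil, or_false, not_or] at hs hd
  simp only [List.mem_cons, List.not_mem_nil, or_false, forall_eq_or_imp, forall_eq] at ht
  refine ((PolyRuns.copy (by simp) (by simp) (by simp) (fun a ha => (ht a ha).2.1) hb).seq <|
    (PolyRuns.move (by simp) ?_).seq <|
    PolyRuns.compareEach (l := l) (l' := l') (Ne.symm hs.2.2.1) (Ne.symm hd.2.2) hsd hll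
      ?_ ?_ ?_ ?_).congr fun a ha => ?_
  · exact hb.mono fun a ha => by simp [ht a ha]
  · intro a ha
    simp [ht a ha, hx a ha]
  · intro a ha
    simp [hs, hsrc a ha]
  · exact hb.mono fun a ha => by simp [ht a ha]
  · simpa [hs] using hb'
  · have := ht a ha
    funext k
    by_cases h : k = dst <;> by_cases h₁ : k = .a <;> by_cases h₂ : k = .t <;>
      by_cases h₃ : k = src <;> simp_all

/-- The state in which a program leaves its answer. -/
def final (c : Bool) : Stk → List Symb := Function.update (fun _ => []) .res [some c]

theorem PolyRuns.cleanUp {c : α → Bool} (hb : ∀ k ≠ .res, PolyBounded D sz fun a => (T a k).length)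
    (hr : ∀ a ∈ D, T a .res = [some (c a)]) :
    PolyRuns D sz (cleanUp M) T fun a => final (c a) := by
  refine (PolyRuns.clearAll _ fun k hk => hb k ?_).congr fun a ha => ?_
  · rintro rfl
    simp at hk
  · have := hr a ha
    funext k
    cases k <;> simp_all [final]

theorem PolyRuns.answer {c : Bool} (hb : ∀ k ≠ .res, PolyBounded D sz fun a => (T a k).length)
    (hr : ∀ a ∈ D, T a .res = []) : PolyRuns D sz (answer M c) T fun _ => final c := by
  refine (PolyRuns.pushSymb _ _).seq (PolyRuns.cleanUp (fun k hk => ?_) fun a ha => ?_)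
  · simpa [hk] using hb k hk
  · simp [hr a ha]

theorem PolyRuns.evaluate_cleanUp (hb : ∀ k ≠ .res, PolyBounded D sz fun a => (T a k).length)
    (hr : ∀ a ∈ D, T a .res = []) :
    PolyRuns D sz ((evaluate M).seq (StackProgram.cleanUp M)) T fun a =>
      final (verdict (finalFlags (T a .exy) (T a .exz) (T a .pb) (T a .q))
        (isOne (T a .kxy).head?) (isOne (T a .kxz).head?)) := by
  choose T' h₁ h₂ h₃ using fun a => runs_evaluate (M := M) (T a)
  have : PolyRuns D sz (evaluate M) T T' :=
    ⟨_, (hb .pb (by simp)).add (.const 1), fun a _ => h₁ a⟩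
  refine this.seq (PolyRuns.cleanUp (fun k hk => (hb k hk).mono fun a _ => h₃ a k hk) ?_)
  intro a ha
  rw [h₂, hr a ha]

/-- The subroutines compute the given functions in polynomial time; the last three need to do so
only for well-formed inputs, and the last one only for feasible vectors. -/
structure Implements (M : Sub → Subroutine Symb) (wf : List Bool → Bool)
    (part : List Bool → List Bool) (feas : List Bool → List (List Bool) → Bool)
    (cls : List Bool → List (List Bool) → List Bool) : Prop where
  recognizes : ∃ p : Polynomial ℕ, ∀ w, (M .wf).Outputs (w.map some) [some (wf w)] (p.eval w.length)
  partitions : ∃ p : Polynomial ℕ, ∀ w, wf w = true →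
    (M .part).Outputs (w.map some) ((part w).map some) (p.eval w.length)
  tests : ∃ p : Polynomial ℕ, ∀ w l, wf w = true →
    (M .feas).Outputs (tupleCode (w :: l)) [some (feas w l)] (p.eval (tupleCode (w :: l)).length)
  classifies : ∃ p : Polynomial ℕ, ∀ w l, wf w = true → feas w l = true →
    (M .cls).Outputs (tupleCode (w :: l)) ((cls w l).map some)
      (p.eval (tupleCode (w :: l)).length)

/-! ### Specification and running time of the verifier -/

section Verifier

variable (wf : List Bool → Bool) (part : List Bool → List Bool)
  (feas : List Bool → List (List Bool) → Bool) (cls : List Bool → List (List Bool) → List Bool)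

/-- The truth value of the condition for disentangledness, for feasible vectors `x`, `y`, `z`. -/
def condition (w : List Bool) (x y z q : List (List Bool)) : Bool :=
  verdict (finalFlags (equalities x y).reverse (equalities x z).reverse
    ((part w).map some).reverse (tupleCode q))
    (decide (cls w x = cls w y)) (decide (cls w x = cls w z))

/-- The truth value of the condition for disentangledness, for arbitrary tuples. -/
def checkedCondition (w : List Bool) (x y z q : List (List Bool)) : Bool :=
  if feas w x then if feas w y then if feas w z then condition part cls w x y z q else false
    else true else true

/-- The tuples `x`, `y`, `q` that are encoded by the bit string `u`, and the rest of `u`. -/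
def decodeChallenge (u : List Bool) :
    List (List Bool) × List (List Bool) × List (List Bool) × List Symb :=
  let x := decodeStrings (u.map some).reverse []
  let y := decodeStrings x.2 []
  let q := decodeStrings y.2 []
  (x.1, y.1, q.1, q.2)

/-- The tuple `z` that is encoded by the bit string `v`, and the rest of `v`. -/
def decodeResponse (v : List Bool) : List (List Bool) × List Symb :=
  decodeStrings (v.map some).reverse []

/-- The truth value computed by the verifier. -/
def verify (a : List Bool × List Bool × List Bool) : Bool :=
  if wf a.1 then checkedCondition part feas cls a.1 (decodeChallenge a.2.1).1
    (decodeChallenge a.2.1).2.1 (decodeResponse a.2.2).1 (decodeChallenge a.2.1).2.2.1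
  else false

variable {wf part feas cls} {M : Sub → Subroutine Symb} {α : Type} {D : Set α} {sz : α → ℕ}

/-- The contents of the stacks after decoding. -/
def decoded (w : List Bool) (x y z q : List (List Bool)) (u v : List Symb) : Stk → List Symb
  | .w => w.map some
  | .x => tupleCode x
  | .y => tupleCode y
  | .z => tupleCode z
  | .q => tupleCode q
  | .u => u
  | .v => v
  | _ => []

section

variable {w : α → List Bool} {x y z q : α → List (List Bool)} {u v : α → List Symb}

theorem Implements.polyOutputs_feas (hM : Implements M wf part feas cls)
    (hw : ∀ a ∈ D, wf (w a) = true) (hbw : PolyBounded D sz fun a => (w a).length)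
    (hbx : PolyBounded D sz fun a => (tupleCode (x a)).length) :
    PolyOutputs D sz (M .feas) (fun a => (w a).map some ++ none :: tupleCode (x a))
      (fun a => [some (feas (w a) (x a))]) := by
  obtain ⟨p, hp⟩ := hM.tests
  refine ⟨fun a => p.eval (tupleCode (w a :: x a)).length, PolyBounded.eval ?_ p, fun a ha => ?_⟩
  · simpa [tupleCode_cons] using hbw.add (hbx.add (.const 1))
  · simpa only [tupleCode_cons] using hp _ _ (hw a ha)

theorem Implements.polyOutputs_cls (hM : Implements M wf part feas cls)
    (hw : ∀ a ∈ D, wf (w a) = true) (hx : ∀ a ∈ D, feas (w a) (x a) = true)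
    (hbw : PolyBounded D sz fun a => (w a).length)
    (hbx : PolyBounded D sz fun a => (tupleCode (x a)).length) :
    PolyOutputs D sz (M .cls) (fun a => (w a).map some ++ none :: tupleCode (x a))
      (fun a => (cls (w a) (x a)).map some) := by
  obtain ⟨p, hp⟩ := hM.classifies
  refine ⟨fun a => p.eval (tupleCode (w a :: x a)).length, PolyBounded.eval ?_ p, fun a ha => ?_⟩
  · simpa [tupleCode_cons] using hbw.add (hbx.add (.const 1))
  · simpa only [tupleCode_cons] using hp _ _ (hw a ha) (hx a ha)

theorem Implements.polyOutputs_part (hM : Implements M wf part feas cls)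
    (hw : ∀ a ∈ D, wf (w a) = true) (hbw : PolyBounded D sz fun a => (w a).length) :
    PolyOutputs D sz (M .part) (fun a => (w a).map some) (fun a => (part (w a)).map some) := by
  obtain ⟨p, hp⟩ := hM.partitions
  exact ⟨fun a => p.eval (w a).length, hbw.eval p, fun a ha => hp _ (hw a ha)⟩

/-- All three vectors are feasible here, so the classifier may be called on them. By `hlen` their
codes have as many entries as there are features, as the entrywise comparison requires. -/
theorem Implements.polyRuns_evaluation (hM : Implements M wf part feas cls)
    (hlen : ∀ w l, wf w = true → feas w l = true → l.length = (part w).length)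
    (hw : ∀ a ∈ D, wf (w a) = true) (hx : ∀ a ∈ D, feas (w a) (x a) = true)
    (hy : ∀ a ∈ D, feas (w a) (y a) = true) (hz : ∀ a ∈ D, feas (w a) (z a) = true)
    (hb : ∀ k, PolyBounded D sz fun a =>
      (decoded (w a) (x a) (y a) (z a) (q a) (u a) (v a) k).length) :
    PolyRuns D sz (evaluation M)
      (fun a => decoded (w a) (x a) (y a) (z a) (q a) (u a) (v a))
      fun a => final (condition part cls (w a) (x a) (y a) (z a) (q a)) := by
  have hbw : PolyBounded D sz fun a => (w a).length := by simpa [decoded] using hb .w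
  have hbx : PolyBounded D sz fun a => (tupleCode (x a)).length := by simpa [decoded] using hb .x
  have hby : PolyBounded D sz fun a => (tupleCode (y a)).length := by simpa [decoded] using hb .y
  have hbz : PolyBounded D sz fun a => (tupleCode (z a)).length := by simpa [decoded] using hb .z
  have hcx := hM.polyOutputs_cls hw hx hbw hbx
  have hcy := hM.polyOutputs_cls hw hy hbw hby
  have hcz := hM.polyOutputs_cls hw hz hbw hbz
  have hp := hM.polyOutputs_part hw hbw
  have hbp := hp.polyBounded (by simpa using hbw)
  have hxy : ∀ a ∈ D, (x a).length = (y a).length := fun a ha =>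
    (hlen _ _ (hw a ha) (hx a ha)).trans (hlen _ _ (hw a ha) (hy a ha)).symm
  have hxz : ∀ a ∈ D, (x a).length = (z a).length := fun a ha =>
    (hlen _ _ (hw a ha) (hx a ha)).trans (hlen _ _ (hw a ha) (hz a ha)).symm
  have hex : ∀ l : α → List (List Bool),
      PolyBounded D sz fun a => ((equalities (x a) (l a)).reverse).length :=
    fun l => hbx.mono fun a _ => by
      simpa [equalities] using .inl (length_le_length_tupleCode _)
  refine ((PolyRuns.compareClasses (by simp) (by simp) (by simp) ?_ hcx hcy ?_ ?_ ?_).seq <|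
    (PolyRuns.compareClasses (by simp) (by simp) (by simp) ?_ (by simpa [decoded] using hcx)
      (by simpa [decoded] using hcz) ?_ ?_ ?_).seq <|
    (PolyRuns.compareWithX (l := x) (l' := y) (by simp) (by simp) (by simp)
      ?_ hxy ?_ ?_ ?_ ?_).seq <|
    (PolyRuns.compareWithX (l := x) (l' := z) (by simp) (by simp) (by simp)
      ?_ hxz ?_ ?_ ?_ ?_).seq <|
    (PolyRuns.callString (by simp) ?_ ?_ (by simpa [decoded] using hp) ?_).seq <|
    PolyRuns.evaluate_cleanUp (fun k hk => ?_) ?_).congr fun a ha => ?_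
  all_goals try simp [decoded, hbw, hbx, hby, hbz]
  · have hy' := hex y
    have hz' := hex z
    have hk' := hb k
    cases k <;> first
      | exact absurd rfl hk
      | (simp [PolyBounded.const]; done)
      | simpa using hk'
      | simpa using hy'
      | simpa using hz'
      | simpa using hbp
  -- The class codes are compared as lists of symbols; `some` is injective, so this agrees with
  -- equality of the bit strings.
  · simp [condition, isOne, (List.map_injective_iff.2 (Option.some_injective Bool)).eq_iff]

theorem Implements.polyRuns_callTuple_feas (hM : Implements M wf part feas cls)
    (hw : ∀ a ∈ D, wf (w a) = true)
    (hb : ∀ k, PolyBounded D sz fun a =>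
      (decoded (w a) (x a) (y a) (z a) (q a) (u a) (v a) k).length)
    {src : Stk} {s : α → List (List Bool)} (hsrc : src ∈ [Stk.x, .y, .z])
    (hs : ∀ a, decoded (w a) (x a) (y a) (z a) (q a) (u a) (v a) src = tupleCode (s a)) :
    PolyRuns D sz (callTuple M .feas src .res)
      (fun a => decoded (w a) (x a) (y a) (z a) (q a) (u a) (v a))
      fun a => Function.update (decoded (w a) (x a) (y a) (z a) (q a) (u a) (v a)) .res
        [some (feas (w a) (s a))] := by
  have hbw : PolyBounded D sz fun a => (w a).length := by simpa [decoded] using hb .w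
  have hbs : PolyBounded D sz fun a => (tupleCode (s a)).length := by simpa [hs] using hb src
  refine (PolyRuns.callTuple (y := fun a => [some (feas (w a) (s a))]) ?_ ?_ (by simp)
    (fun a _ => rfl) (fun a _ => rfl) ?_ (hb .w) (hb src)).congr fun a _ => ?_
  · rintro rfl; simp at hsrc
  · rintro rfl; simp at hsrc
  · simp only [hs]
    exact hM.polyOutputs_feas hw hbw hbs
  · simp [decoded]

theorem update_res_decoded (w : List Bool) (x y z q : List (List Bool)) (u v : List Symb) :
    Function.update (decoded w x y z q u v) .res [] = decoded w x y z q u v :=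
  Function.update_eq_self_iff.2 rfl

/-- Each successful test shrinks the domain, until `polyRuns_evaluation` applies on the inputs with
three feasible vectors. A failing branch only has to leave the right constant. -/
theorem Implements.polyRuns_tests (hM : Implements M wf part feas cls)
    (hlen : ∀ w l, wf w = true → feas w l = true → l.length = (part w).length)
    (hw : ∀ a ∈ D, wf (w a) = true)
    (hb : ∀ k, PolyBounded D sz fun a =>
      (decoded (w a) (x a) (y a) (z a) (q a) (u a) (v a) k).length) :
    PolyRuns D sz
      ((callTuple M .feas .x .res).seq <| ifPop .res
        ((callTuple M .feas .y .res).seq <| ifPop .res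
          ((callTuple M .feas .z .res).seq <| ifPop .res (evaluation M) (answer M false))
          (answer M true))
        (answer M true))
      (fun a => decoded (w a) (x a) (y a) (z a) (q a) (u a) (v a))
      fun a => final (checkedCondition part feas cls (w a) (x a) (y a) (z a) (q a)) := by
  have hs : ∀ (D' : Set α) (c : α → Bool), D' ⊆ D → {a ∈ D' | c a = true} ⊆ D :=
    fun D' c h a ha => h ha.1
  have hs' : ∀ (D' : Set α) (c : α → Bool), D' ⊆ D → {a ∈ D' | c a = false} ⊆ D :=
    fun D' c h a ha => h ha.1
  have hans : ∀ (D' : Set α) (c : Bool), D' ⊆ D → PolyRuns D' sz (answer M c)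
      (fun a => decoded (w a) (x a) (y a) (z a) (q a) (u a) (v a)) fun _ => final c :=
    fun D' c h => PolyRuns.answer (fun k _ => (hb k).subset h) fun a _ => rfl
  refine (hM.polyRuns_callTuple_feas hw hb (src := .x) (s := x) (by simp) fun _ => rfl).seq
    (PolyRuns.ifPop (c := fun a => feas (w a) (x a)) (x := fun _ => []) (by simp) ?_ ?_)
  all_goals simp only [Function.update_idem, update_res_decoded]
  rotate_left
  · refine (hans _ true (hs' _ _ subset_rfl)).congr fun a ha => ?_
    simp [checkedCondition, ha.2]
  have h₁ := hs D (fun a => feas (w a) (x a)) subset_rfl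
  refine (hM.polyRuns_callTuple_feas (fun a ha => hw a (h₁ ha)) (fun k => (hb k).subset h₁)
    (src := .y) (s := y) (by simp) fun _ => rfl).seq
    (PolyRuns.ifPop (c := fun a => feas (w a) (y a)) (x := fun _ => []) (by simp) ?_ ?_)
  all_goals simp only [Function.update_idem, update_res_decoded]
  rotate_left
  · refine (hans _ true (hs' _ _ h₁)).congr fun a ha => ?_
    simp [checkedCondition, ha.2]
  have h₂ := hs _ (fun a => feas (w a) (y a)) h₁
  refine (hM.polyRuns_callTuple_feas (fun a ha => hw a (h₂ ha)) (fun k => (hb k).subset h₂)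
    (src := .z) (s := z) (by simp) fun _ => rfl).seq
    (PolyRuns.ifPop (c := fun a => feas (w a) (z a)) (x := fun _ => []) (by simp) ?_ ?_)
  all_goals simp only [Function.update_idem, update_res_decoded]
  rotate_left
  · refine (hans _ false (hs' _ _ h₂)).congr fun a ha => ?_
    simp [checkedCondition, ha.1.1.2, ha.1.2, ha.2]
  have h₃ := hs _ (fun a => feas (w a) (z a)) h₂
  refine (hM.polyRuns_evaluation hlen (fun a ha => hw a (h₃ ha)) (fun a ha => ha.1.1.2)
    (fun a ha => ha.1.2) (fun a ha => ha.2) (fun k => (hb k).subset h₃)).congr fun a ha => ?_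
  simp [checkedCondition, ha.1.1.2, ha.1.2, ha.2]

end

theorem decodeFrom_nil (x : List Symb) :
    decodeFrom x [] = (tupleCode (decodeStrings x []).1, (decodeStrings x []).2) :=
  decodeFrom_tupleCode x []

theorem Implements.polyRuns_verification (hM : Implements M wf part feas cls)
    (hlen : ∀ w l, wf w = true → feas w l = true → l.length = (part w).length)
    {w u v : α → List Bool} (hw : ∀ a ∈ D, wf (w a) = true)
    (hbw : PolyBounded D sz fun a => (w a).length)
    (hbu : PolyBounded D sz fun a => (u a).length)
    (hbv : PolyBounded D sz fun a => (v a).length) :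
    PolyRuns D sz (verification M)
      (fun a => decoded (w a) [] [] [] [] ((u a).map some).reverse ((v a).map some).reverse)
      fun a => final (checkedCondition part feas cls (w a) (decodeChallenge (u a)).1
        (decodeChallenge (u a)).2.1 (decodeResponse (v a)).1 (decodeChallenge (u a)).2.2.1) := by
  have hdec : ∀ s : List Symb, (tupleCode (decodeStrings s []).1).length +
      (decodeStrings s []).2.length ≤ s.length := fun s => length_decodeStrings_le s []
  let x a := decodeStrings ((u a).map some).reverse []
  let y a := decodeStrings (x a).2 []
  let q a := decodeStrings (y a).2 []
  let z a := decodeStrings ((v a).map some).reverse []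
  have hx : ∀ a, (tupleCode (x a).1).length + (x a).2.length ≤ (u a).length :=
    fun a => by simpa using hdec ((u a).map some).reverse
  have hy : ∀ a, (tupleCode (y a).1).length + (y a).2.length ≤ (x a).2.length := fun a => hdec _
  have hq : ∀ a, (tupleCode (q a).1).length + (q a).2.length ≤ (y a).2.length := fun a => hdec _
  have hz : ∀ a, (tupleCode (z a).1).length + (z a).2.length ≤ (v a).length :=
    fun a => by simpa using hdec ((v a).map some).reverse
  have h₁ : PolyRuns D sz (decode M .u .x)
      (fun a => decoded (w a) [] [] [] [] ((u a).map some).reverse ((v a).map some).reverse)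
      (fun a => decoded (w a) (x a).1 [] [] [] (x a).2 ((v a).map some).reverse) :=
    (PolyRuns.decode (by simp) (by simpa [decoded] using hbu)).congr fun a _ => by
      funext k
      cases k <;> simp [decoded, decodeFrom_nil, x]
  have h₂ : PolyRuns D sz (decode M .u .y)
      (fun a => decoded (w a) (x a).1 [] [] [] (x a).2 ((v a).map some).reverse)
      (fun a => decoded (w a) (x a).1 (y a).1 [] [] (y a).2 ((v a).map some).reverse) :=
    (PolyRuns.decode (by simp) (hbu.mono fun a _ => by
      have := hx a; dsimp only [decoded]; omega)).congr fun a _ => by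
      funext k
      cases k <;> simp [decoded, decodeFrom_nil, y]
  have h₃ : PolyRuns D sz (decode M .u .q)
      (fun a => decoded (w a) (x a).1 (y a).1 [] [] (y a).2 ((v a).map some).reverse)
      (fun a => decoded (w a) (x a).1 (y a).1 [] (q a).1 (q a).2 ((v a).map some).reverse) :=
    (PolyRuns.decode (by simp) (hbu.mono fun a _ => by
      have := hx a; have := hy a; dsimp only [decoded]; omega)).congr fun a _ => by
      funext k
      cases k <;> simp [decoded, decodeFrom_nil, q]
  have h₄ : PolyRuns D sz (decode M .v .z)
      (fun a => decoded (w a) (x a).1 (y a).1 [] (q a).1 (q a).2 ((v a).map some).reverse)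
      (fun a => decoded (w a) (x a).1 (y a).1 (z a).1 (q a).1 (q a).2 (z a).2) :=
    (PolyRuns.decode (by simp) (by simpa [decoded] using hbv)).congr fun a _ => by
      funext k
      cases k <;> simp [decoded, decodeFrom_nil, z]
  refine h₁.seq (h₂.seq (h₃.seq (h₄.seq (hM.polyRuns_tests hlen hw fun k => ?_))))
  cases k with
  | w => simpa [decoded] using hbw
  | v => exact hbv.mono fun a _ => by have := hz a; dsimp only [decoded]; omega
  | z => exact hbv.mono fun a _ => by have := hz a; dsimp only [decoded]; omega
  | u =>
    refine hbu.mono fun a _ => ?_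
    have := hx a; have := hy a; have := hq a; dsimp only [decoded]; omega
  | x => exact hbu.mono fun a _ => by have := hx a; dsimp only [decoded]; omega
  | y =>
    refine hbu.mono fun a _ => ?_
    have := hx a; have := hy a; dsimp only [decoded]; omega
  | q =>
    refine hbu.mono fun a _ => ?_
    have := hx a; have := hy a; have := hq a; dsimp only [decoded]; omega
  | _ => exact PolyBounded.const 0

/-- The code of the input of the verifier. -/
def tripleCode (a : List Bool × List Bool × List Bool) : List Symb :=
  tupleCode [a.1, a.2.1, a.2.2]

theorem length_tripleCode (a : List Bool × List Bool × List Bool) :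
    (tripleCode a).length = a.1.length + a.2.1.length + a.2.2.length + 3 := by
  simp [tripleCode, tupleCode_cons]
  omega

theorem Implements.polyRuns_verifier (hM : Implements M wf part feas cls)
    (hlen : ∀ w l, wf w = true → feas w l = true → l.length = (part w).length) :
    PolyRuns Set.univ (fun a => (tripleCode a).length) (verifier M)
      (fun a => Function.update (fun _ => []) .inp (tripleCode a))
      fun a => final (verify wf part feas cls a) := by
  have hbw : PolyBounded Set.univ (fun a => (tripleCode a).length) fun a => a.1.length :=
    PolyBounded.size.mono fun a _ => by rw [length_tripleCode]; omega
  have hbu : PolyBounded Set.univ (fun a => (tripleCode a).length) fun a => a.2.1.length :=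
    PolyBounded.size.mono fun a _ => by rw [length_tripleCode]; omega
  have hbv : PolyBounded Set.univ (fun a => (tripleCode a).length) fun a => a.2.2.length :=
    PolyBounded.size.mono fun a _ => by rw [length_tripleCode]; omega
  have hread : PolyRuns Set.univ (fun a => (tripleCode a).length)
      (readInput M)
      (fun a => Function.update (fun _ => []) .inp (tripleCode a))
      (fun a => decoded a.1 [] [] [] [] (a.2.1.map some).reverse (a.2.2.map some).reverse) := by
    refine ((PolyRuns.takeString (x := fun a => a.1) (y := fun a => tupleCode [a.2.1, a.2.2])
      (by simp) ?_ hbw).seq <| (PolyRuns.move (by simp) ?_).seq <|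
      (PolyRuns.takeString (x := fun a => a.2.1) (y := fun a => tupleCode [a.2.2])
        (by simp) ?_ hbu).seq <|
      PolyRuns.takeString (x := fun a => a.2.2) (y := fun a => []) (by simp) ?_ hbv).congr ?_
    · simp [tripleCode, tupleCode_cons]
    · simpa using hbw
    · simp [tupleCode_cons]
    · simp [tupleCode_cons]
    · rintro ⟨w, u, v⟩ -
      funext k
      cases k <;> simp [decoded]
  obtain ⟨p, hp⟩ := hM.recognizes
  have hwf : PolyRuns Set.univ (fun a => (tripleCode a).length) (callString M .wf .res)
      (fun a => decoded a.1 [] [] [] [] (a.2.1.map some).reverse (a.2.2.map some).reverse)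
      fun a => Function.update (decoded a.1 [] [] [] [] (a.2.1.map some).reverse
        (a.2.2.map some).reverse) .res [some (wf a.1)] :=
    (PolyRuns.callString (y := fun a => [some (wf a.1)]) (by simp) (fun _ _ => rfl)
      (fun _ _ => rfl) ⟨_, hbw.eval p, fun a _ => hp a.1⟩ (by simpa [decoded] using hbw)).congr
        fun a _ => by simp [decoded]
  have hrest : PolyRuns Set.univ (fun a => (tripleCode a).length)
      (ifPop .res (verification M) (answer M false))
      (fun a => Function.update (decoded a.1 [] [] [] [] (a.2.1.map some).reverse
        (a.2.2.map some).reverse) .res [some (wf a.1)])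
      fun a => final (verify wf part feas cls a) := by
    refine PolyRuns.ifPop (c := fun a => wf a.1) (x := fun _ => []) (by simp) ?_ ?_
    all_goals simp only [Function.update_idem, update_res_decoded]
    · refine (hM.polyRuns_verification hlen (fun a ha => ha.2) (hbw.subset (Set.subset_univ _))
        (hbu.subset (Set.subset_univ _)) (hbv.subset (Set.subset_univ _))).congr fun a ha => ?_
      simp only [verify, show wf a.1 = true from ha.2, if_true]
    · refine (PolyRuns.answer (fun k _ => ?_) fun a _ => rfl).congr fun a ha => ?_
      · cases k with
        | w => simpa [decoded] using hbw.subset (Set.subset_univ _)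
        | u => simpa [decoded] using hbu.subset (Set.subset_univ _)
        | v => simpa [decoded] using hbv.subset (Set.subset_univ _)
        | _ => exact PolyBounded.const 0
      · simp [verify, ha.2]
  exact hread.seq (hwf.seq hrest)

end Verifier

end StackProgram

/-! ### Prenex forms of looseness and disentangledness -/

/-! ### The characterizations -/

section Characterizations

variable {F : Type*} {D : F → Type*} {K : Type*}

theorem isDisentangled_iff_forall_exists (C : Set (Set (∀ i, D i))) (P : Set F)
    (κ : Feasible C → K) :
    IsDisentangled C P κ ↔
      ∀ x y : Feasible C, ∀ Q : Set F, ∃ z : Feasible C,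
        (¬ AgreeOn Pᶜ y.1 x.1 ∨ κ y = κ x) ∧
          (Q ∩ P = ∅ ∨ (AgreeOn Q z.1 x.1 ∧ κ z ≠ κ x) ∨
            (¬ AgreeOn Q y.1 x.1 ∨ AgreeOn Pᶜ y.1 x.1) ∨
            (AgreeOn Pᶜ z.1 x.1 ∧ ¬ AgreeOn Q z.1 x.1)) := by
  constructor
  · intro h x y Q
    have h₁ : ¬ AgreeOn Pᶜ y.1 x.1 ∨ κ y = κ x := by
      have := (h x).1 y
      tauto
    by_cases hQ : IsWeakAXp C κ x Q
    · by_cases hs : Subsumes C x Q Pᶜ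
      -- The remaining alternatives do not involve `z`, so any feasible vector serves.
      · refine ⟨x, h₁, ?_⟩
        rcases Set.eq_empty_or_nonempty (Q ∩ P) with he | hne
        · exact .inl he
        · have := (h x).2 Q hQ hne
          have hN : Subsumes C x Pᶜ Q := by
            by_contra hN
            exact this ⟨hs, hN⟩
          have := hN y
          tauto
      · simp only [Subsumes, not_forall] at hs
        obtain ⟨z, hz, hz'⟩ := hs
        -- The witness is a counterexample to `x_Q` subsuming `x_N`; in the last case below it is a
        -- counterexample to `Q` being a weak AXp.
        exact ⟨z, h₁, .inr (.inr (.inr ⟨hz, hz'⟩))⟩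
    · simp only [IsWeakAXp, not_forall] at hQ
      obtain ⟨z, hz, hz'⟩ := hQ
      exact ⟨z, h₁, .inr (.inl ⟨hz, hz'⟩)⟩
  · intro h x
    refine ⟨fun y hy => ?_, fun Q hQ hne hs => hs.2 fun y hy => ?_⟩
    -- The first conjunct does not depend on `Q`, so any set will do.
    · obtain ⟨z, hz, -⟩ := h x y ∅
      tauto
    · obtain ⟨z, -, hz⟩ := h x y Q
      have h₁ := hQ z
      have h₂ := hs.1 z
      have h₃ := hne.ne_empty
      tauto

theorem isLoose_iff_forall_exists (C : Set (Set (∀ i, D i))) (P : Set F) :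
    IsLoose C P ↔
      ∀ x y : Feasible C, ∀ p ∈ P, ∃ z : Feasible C,
        (¬ AgreeOn {p} y.1 x.1 ∨ AgreeOn Pᶜ y.1 x.1) ∨
          (AgreeOn Pᶜ z.1 x.1 ∧ ¬ AgreeOn {p} z.1 x.1) := by
  constructor
  · intro h x y p hp
    by_cases hs : Subsumes C x {p} Pᶜ
    · refine ⟨x, .inl ?_⟩
      have hN : Subsumes C x Pᶜ {p} := by
        by_contra hN
        exact h x p hp ⟨hs, hN⟩
      have := hN y
      tauto
    · simp only [Subsumes, not_forall] at hs
      obtain ⟨z, hz, hz'⟩ := hs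
      exact ⟨z, .inr ⟨hz, hz'⟩⟩
  · intro h x p hp hs
    refine hs.2 fun y hy => ?_
    obtain ⟨z, hz⟩ := h x y p hp
    have := hs.1 z
    tauto

/-- Looseness is disentangledness of a constant classifier. -/
theorem isLoose_iff_isDisentangled_const (C : Set (Set (∀ i, D i))) (P : Set F) (c : K) :
    IsLoose C P ↔ IsDisentangled C P fun _ => c := by
  constructor
  · intro h x
    -- If `x_Q` strictly subsumes `x_N` and `p ∈ Q ∩ P`, then so does `x_{p}`: it is determined by
    -- `x_N` as part of `x_Q`, and if it determined `x_N`, then `x_Q` would as well.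
    refine ⟨fun _ _ => rfl, fun Q _ ⟨p, hpQ, hpP⟩ hs => h x p hpP ⟨fun y hy i hi => ?_, fun hp => ?_⟩⟩
    · rw [Set.mem_singleton_iff] at hi
      exact hi ▸ hs.1 y hy p hpQ
    · exact hs.2 fun y hy => hp y fun i hi => (Set.mem_singleton_iff.1 hi) ▸ hy p hpQ
  · intro h x p hp hs
    exact (h x).2 {p} (fun _ _ => rfl) ⟨p, rfl, hp⟩ hs

end Characterizations

/-! ### From the hypotheses on the inputs to the machine of the verifier -/

namespace ClassifierInputs

open StackProgram Classical

variable {ι : Type} (I : ClassifierInputs ι)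

theorem vecCode_injective (a : ι) : Function.Injective (I.vecCode a) := by
  intro x y h
  funext i
  have := congrFun (List.ofFn_injective h) i
  exact I.code_injective a i this

/-- The class of a vector that is given by its code, as a bit string. -/
noncomputable def classOf (w : List Bool) (l : List (List Bool)) : List Bool :=
  if h : ∃ t : (a : ι) × Feasible (I.C a), I.enc t.1 = w ∧ I.vecCode t.1 t.2.1 = l then
    I.classCode h.choose.1 (I.κ h.choose.1 h.choose.2) else []

/-- The choice in `classOf` is harmless, since injectivity of the encodings leaves only one input
and one vector to choose. -/
theorem classOf_enc (a : ι) (x : Feasible (I.C a)) :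
    I.classOf (I.enc a) (I.vecCode a x.1) = I.classCode a (I.κ a x) := by
  have h : ∃ t : (a : ι) × Feasible (I.C a), I.enc t.1 = I.enc a ∧
      I.vecCode t.1 t.2.1 = I.vecCode a x.1 := ⟨⟨a, x⟩, rfl, rfl⟩
  rw [classOf, dif_pos h]
  generalize hc : h.choose = t
  have ht := h.choose_spec
  rw [hc] at ht
  obtain ⟨b, y⟩ := t
  obtain rfl := I.enc_injective ht.1
  obtain rfl : y = x := Subtype.ext (I.vecCode_injective b ht.2)
  rfl

/-- The protected features, as a bit string. -/
noncomputable def partitionBits (a : ι) : List Bool :=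
  List.ofFn fun i : Fin (I.n a) => decide (i ∈ I.P a)

/-- The protected features of the input with code `w`. -/
noncomputable def partitionOf (w : List Bool) : List Bool :=
  if h : ∃ a, I.enc a = w then I.partitionBits h.choose else []

theorem choose_enc {a : ι} (h : ∃ b, I.enc b = I.enc a) : h.choose = a :=
  I.enc_injective h.choose_spec

theorem partitionOf_enc (a : ι) : I.partitionOf (I.enc a) = I.partitionBits a := by
  have h : ∃ b, I.enc b = I.enc a := ⟨a, rfl⟩
  rw [partitionOf, dif_pos h, I.choose_enc h]

/-- Whether `w` is the code of an input. -/
noncomputable def wellFormedBit (w : List Bool) : Bool := decide (w ∈ Set.range I.enc)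

/-- Whether `l` is the code of a feasible vector of the input with code `w`. -/
noncomputable def feasibleBit (w : List Bool) (l : List (List Bool)) : Bool :=
  decide (∃ a, I.enc a = w ∧ ∃ x ∈ Feasible (I.C a), I.vecCode a x = l)

theorem feasibleBit_enc (a : ι) (l : List (List Bool)) :
    I.feasibleBit (I.enc a) l = true ↔ ∃ x : Feasible (I.C a), I.vecCode a x.1 = l := by
  simp only [feasibleBit, decide_eq_true_eq]
  constructor
  · rintro ⟨b, hb, x, hx, h⟩
    obtain rfl := I.enc_injective hb
    exact ⟨⟨x, hx⟩, h⟩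
  · rintro ⟨x, hx⟩
    exact ⟨a, rfl, x.1, x.2, hx⟩

/-- The value computed by the verifier for disentangledness. -/
noncomputable def verifyBit (t : List Bool × List Bool × List Bool) : Bool :=
  verify I.wellFormedBit I.partitionOf I.feasibleBit I.classOf t

/-- The specifications are total functions of bit strings with arbitrary default values. They have
to agree with the machines only where `Implements` asks for it. -/
theorem polyTimeDecidable_verifyBit (h : I.PolyTimeCheckable) (hκ : I.PolyTimeEvaluable) :
    PolyTimeDecidable tripleCode fun t => I.verifyBit t = true := by
  obtain ⟨f, hf, ⟨mwf⟩⟩ := h.wellFormed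
  obtain ⟨mpart⟩ := h.partition
  obtain ⟨g, hg, ⟨mfeas⟩⟩ := h.feasible
  obtain ⟨mcls⟩ := hκ
  let M : Sub → Subroutine Symb
    | .wf => .ofComputable mwf (fun s => s.getD false) some
    | .part => .ofComputable mpart (fun s => s.getD false) some
    | .feas => .ofComputable mfeas id some
    | .cls => .ofComputable mcls id some
  have hmap : ∀ w : List Bool, (w.map some).map (fun s => s.getD false) = w := by
    intro w
    simp [Function.comp_def]
  have hM : Implements M I.wellFormedBit I.partitionOf I.feasibleBit I.classOf := by
    refine ⟨⟨mwf.time, fun w => ?_⟩, ⟨mpart.time, fun w hw => ?_⟩, ⟨mfeas.time, fun w l hw => ?_⟩,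
      ⟨mcls.time, fun w l hw hl => ?_⟩⟩
    · have := Subroutine.outputs_ofComputable mwf (fun s => s.getD false) some (hmap w)
      have hfw : I.wellFormedBit w = f w := by
        rw [Bool.eq_iff_iff, hf, wellFormedBit, decide_eq_true_eq]
      rw [hfw]
      rw [List.length_map] at this
      exact this
    · obtain ⟨a, rfl⟩ : w ∈ Set.range I.enc := by simpa [wellFormedBit] using hw
      have := Subroutine.outputs_ofComputable mpart (fun s => s.getD false) some
        (hmap (I.enc a))
      rw [I.partitionOf_enc]
      rw [List.length_map] at this
      exact this
    · obtain ⟨a, rfl⟩ : w ∈ Set.range I.enc := by simpa [wellFormedBit] using hw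
      have := Subroutine.outputs_ofComputable mfeas id some (x := tupleCode (I.enc a :: l))
        (a := (a, l)) (List.map_id _)
      have hfw : I.feasibleBit (I.enc a) l = g (a, l) := by
        rw [Bool.eq_iff_iff, hg, I.feasibleBit_enc]
        simp
      rw [hfw]
      exact this
    · obtain ⟨a, rfl⟩ : w ∈ Set.range I.enc := by simpa [wellFormedBit] using hw
      obtain ⟨x, rfl⟩ := (I.feasibleBit_enc a l).1 hl
      rw [I.classOf_enc]
      exact Subroutine.outputs_ofComputable mcls id some
        (x := tupleCode (I.enc a :: I.vecCode a x.1)) (a := ⟨a, x⟩) (List.map_id _)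
  -- The recognizer of well-formed inputs answers with a Boolean, so it supplies the output
  -- alphabet.
  refine polyTimeDecidable_of_polyRuns tripleCode .wf mwf.outputAlphabet (verifier M) .inp .res _
    (hM.polyRuns_verifier fun w l hw hl => ?_)
  obtain ⟨a, rfl⟩ : w ∈ Set.range I.enc := by simpa [wellFormedBit] using hw
  obtain ⟨x, rfl⟩ := (I.feasibleBit_enc a l).1 hl
  rw [I.partitionOf_enc]
  simp [partitionBits, ConstraintInputs.vecCode]

/-! ### Correctness of the verifier -/

theorem getElem?_reverse_ofFn {β : Type} {n : ℕ} (f : Fin n → β) (i : Fin n) :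
    (List.ofFn f).reverse[(i.rev : ℕ)]? = some (f i) := by
  rw [List.getElem?_reverse (by have := i.2; simp; omega)]
  have : (List.ofFn f).length - 1 - (i.rev : ℕ) = i := by
    have := i.2
    simp only [List.length_ofFn, Fin.val_rev]
    omega
  rw [this]
  simp

theorem equalities_vecCode (a : ι) (x y : ∀ i, I.Dom a i) :
    equalities (I.vecCode a x) (I.vecCode a y) =
      List.ofFn fun i => some (decide (y i = x i)) := by
  refine List.ext_getElem (by simp [equalities, ConstraintInputs.vecCode]) fun j h₁ h₂ => ?_
  simp only [equalities, ConstraintInputs.vecCode, List.getElem_zipWith, List.getElem_ofFn,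
    (I.code_injective a _).eq_iff, Option.some.injEq, decide_eq_decide]
  exact eq_comm

/-- Each flag is a conjunction over all features, and so is the assertion it stands for. Equalities
and partition lie reversed on their stacks, so feature `i` is found at position `i.rev`, and `q` is
read in the same order. -/
theorem condition_eq_true_iff (a : ι) (x y z : Feasible (I.C a)) (q : List (List Bool))
    (Q : Set (Fin (I.n a)))
    (hQ : ∀ i : Fin (I.n a), i ∈ Q ↔ isOne (tupleCode q)[(i.rev : ℕ)]? = true) :
    condition I.partitionOf I.classOf (I.enc a) (I.vecCode a x.1) (I.vecCode a y.1)
        (I.vecCode a z.1) q = true ↔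
      (¬ AgreeOn (I.P a : Set (Fin (I.n a)))ᶜ y.1 x.1 ∨ I.κ a y = I.κ a x) ∧
          (Q ∩ I.P a = ∅ ∨ (AgreeOn Q z.1 x.1 ∧ I.κ a z ≠ I.κ a x) ∨
            (¬ AgreeOn Q y.1 x.1 ∨ AgreeOn (I.P a : Set (Fin (I.n a)))ᶜ y.1 x.1) ∨
            (AgreeOn (I.P a : Set (Fin (I.n a)))ᶜ z.1 x.1 ∧ ¬ AgreeOn Q z.1 x.1)) := by
  have hflag : ∀ k, finalFlags (equalities (I.vecCode a x.1) (I.vecCode a y.1)).reverse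
      (equalities (I.vecCode a x.1) (I.vecCode a z.1)).reverse
      ((I.partitionOf (I.enc a)).map some).reverse (tupleCode q) k = true ↔
      ∀ i : Fin (I.n a), featureTest k (some (some (decide (y.1 i = x.1 i))))
        (some (some (decide (z.1 i = x.1 i)))) (some (some (decide (i ∈ I.P a))))
        (tupleCode q)[(i.rev : ℕ)]? = true := by
    intro k
    have hp : (I.partitionOf (I.enc a)).map some =
        List.ofFn fun i : Fin (I.n a) => some (decide (i ∈ I.P a)) := by
      rw [I.partitionOf_enc, partitionBits, List.map_ofFn]
      rfl
    rw [finalFlags, decide_eq_true_eq, hp, I.equalities_vecCode, I.equalities_vecCode]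
    simp only [List.length_reverse, List.length_ofFn]
    constructor
    · intro h i
      have := h i.rev i.rev.2
      rwa [getElem?_reverse_ofFn, getElem?_reverse_ofFn, getElem?_reverse_ofFn] at this
    · intro h j hj
      have := h (Fin.rev ⟨j, hj⟩)
      rw [← getElem?_reverse_ofFn (fun i => some (decide (y.1 i = x.1 i))),
        ← getElem?_reverse_ofFn (fun i => some (decide (z.1 i = x.1 i))),
        ← getElem?_reverse_ofFn (fun i => some (decide (i ∈ I.P a)))] at this
      simpa using this
  have hN : ∀ y' : Feasible (I.C a), AgreeOn (I.P a : Set (Fin (I.n a)))ᶜ y'.1 x.1 ↔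
      ∀ i, (isOne (some (some (decide (i ∈ I.P a)))) ||
        isOne (some (some (decide (y'.1 i = x.1 i))))) = true := by
    intro y'
    refine forall_congr' fun i => ?_
    by_cases hi : i ∈ I.P a <;> simp [hi, isOne]
  have hS : ∀ y' : Feasible (I.C a), AgreeOn Q y'.1 x.1 ↔
      ∀ i, (!isOne (tupleCode q)[(i.rev : ℕ)]? ||
        isOne (some (some (decide (y'.1 i = x.1 i))))) = true := by
    intro y'
    refine forall_congr' fun i => ?_
    rw [hQ]
    cases isOne (tupleCode q)[(i.rev : ℕ)]? <;> simp [isOne]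
  have hE : Q ∩ I.P a = ∅ ↔ ∀ i, (!(isOne (some (some (decide (i ∈ I.P a)))) &&
      isOne (tupleCode q)[(i.rev : ℕ)]?)) = true := by
    rw [Set.eq_empty_iff_forall_notMem]
    refine forall_congr' fun i => ?_
    rw [Set.mem_inter_iff, hQ]
    by_cases hi : i ∈ I.P a <;> simp [hi, isOne]
  have hk : ∀ y' : Feasible (I.C a), I.κ a y' = I.κ a x ↔
      I.classOf (I.enc a) (I.vecCode a x.1) = I.classOf (I.enc a) (I.vecCode a y'.1) := by
    intro y'
    rw [I.classOf_enc, I.classOf_enc, (I.classCode_injective a).eq_iff, eq_comm]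
  have e0 := (hN y).trans (hflag 0).symm
  have e1 := (hS y).trans (hflag 1).symm
  have e2 := (hN z).trans (hflag 2).symm
  have e3 := (hS z).trans (hflag 3).symm
  have e4 := hE.trans (hflag 4).symm
  rw [e0, e1, e2, e3, e4, hk y, Ne, hk z]
  simp only [condition, verdict_eq_true_iff, decide_eq_true_eq]

/-- Testing disentangledness belongs to `Π₂ᴾ`. -/
theorem inPi2P_disentangledness (h : I.PolyTimeCheckable) (hκ : I.PolyTimeEvaluable) :
    InPi2P I.disentangledness := by
  obtain ⟨b, hb⟩ := h.size
  -- A symbol takes two bits. The vectors `x` and `y` need `2 * b` each; `Q` needs `2 * (n + 1)`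
  -- with `n ≤ b`; the two terminators `00` add 4. The sum is at most `6 * b + 6`.
  refine ⟨.C 6 * b + .C 6, fun w u v => I.verifyBit (w, u, v) = true,
    I.polyTimeDecidable_verifyBit h hκ, fun w => ⟨?_, fun hw => ?_⟩⟩
  · rintro ⟨a, ha, rfl⟩ u hu
    have ha' := (isDisentangled_iff_forall_exists _ _ _).1 ha
    have hwf : I.wellFormedBit (I.enc a) = true := by simp [wellFormedBit]
    by_cases hx : I.feasibleBit (I.enc a) (decodeChallenge u).1 = true
    · by_cases hy : I.feasibleBit (I.enc a) (decodeChallenge u).2.1 = true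
      · obtain ⟨x, hx'⟩ := (I.feasibleBit_enc a _).1 hx
        obtain ⟨y, hy'⟩ := (I.feasibleBit_enc a _).1 hy
        -- Every decoded `q`, however malformed, describes some set of features, so a challenge with
        -- feasible `x` and `y` is an instance of the prenex form.
        obtain ⟨z, hz⟩ := ha' x y
          {i | isOne (tupleCode (decodeChallenge u).2.2.1)[(i.rev : ℕ)]? = true}
        refine ⟨(symbBits (tupleCode (I.vecCode a z.1)).reverse).reverse, ?_, ?_⟩
        · have := hb a z.1 z.2
          simp only [List.length_reverse, length_symbBits, Polynomial.eval_add,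
            Polynomial.eval_mul, Polynomial.eval_C]
          omega
        · have hdec : (decodeResponse
              (symbBits (tupleCode (I.vecCode a z.1)).reverse).reverse).1 = I.vecCode a z.1 := by
            have := decodeStrings_symbBits (I.vecCode a z.1) []
            rw [List.append_nil] at this
            rw [decodeResponse, List.map_reverse, List.reverse_reverse, this]
            rfl
          have hfz : I.feasibleBit (I.enc a) (I.vecCode a z.1) = true :=
            (I.feasibleBit_enc a _).2 ⟨z, rfl⟩
          have := (I.condition_eq_true_iff a x y z (decodeChallenge u).2.2.1 _
            (fun _ => Iff.rfl)).2 hz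
          rw [hx', hy'] at this
          simp only [verifyBit, verify, hwf, checkedCondition, hx, hy, hdec, hfz, if_true, this]
      -- A challenge with an infeasible vector is accepted whatever the response is.
      · exact ⟨[], by simp, by simp [verifyBit, verify, hwf, checkedCondition, hy]⟩
    · exact ⟨[], by simp, by simp [verifyBit, verify, hwf, checkedCondition, hx]⟩
  · have hwf : I.wellFormedBit w = true := by
      -- Even one accepted challenge shows that `w` is well-formed, because the verifier tests this
      -- first.
      obtain ⟨v, -, hv⟩ := hw [] (by simp)
      by_contra hwf
      simp [verifyBit, verify, hwf] at hv
    obtain ⟨a, rfl⟩ : w ∈ Set.range I.enc := by simpa [wellFormedBit] using hwf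
    refine ⟨a, (isDisentangled_iff_forall_exists _ _ _).2 fun x y Q => ?_, rfl⟩
    -- A single string, the characteristic vector of `Q` in reverse order, to match the order on the
    -- other stacks.
    let q : List (List Bool) := [List.ofFn fun j : Fin (I.n a) => decide (j.rev ∈ Q)]
    have hq : tupleCode q = (List.ofFn fun j : Fin (I.n a) => some (decide (j.rev ∈ Q))) ++
        [none] := by
      simp only [q, tupleCode_cons, tupleCode_nil, List.map_ofFn]
      rfl
    have hQ : ∀ i : Fin (I.n a), i ∈ Q ↔ isOne (tupleCode q)[(i.rev : ℕ)]? = true := by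
      intro i
      rw [hq, List.getElem?_append_left (by have := i.2; simp; omega), List.getElem?_ofFn,
        dif_pos i.rev.2]
      change _ ↔ isOne (some (some (decide (i.rev.rev ∈ Q)))) = true
      rw [Fin.rev_rev]
      simp [isOne]
    -- `takeString` leaves `u` reversed on its stack, so the string is reversed in advance; `00`
    -- separates the three tuples.
    let u : List Bool := (symbBits (tupleCode (I.vecCode a x.1)).reverse ++
      ([false, false] ++ (symbBits (tupleCode (I.vecCode a y.1)).reverse ++
      ([false, false] ++ symbBits (tupleCode q).reverse)))).reverse
    have hu : decodeChallenge u = (I.vecCode a x.1, I.vecCode a y.1, q, []) := by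
      have h₁ : ∀ (l : List (List Bool)) (s : List Symb),
          decodeStrings (some false :: some false :: s) l = (l, s) := by
        intro l s
        simp [decodeStrings]
      have h₂ : ∀ l : List (List Bool),
          decodeStrings ((symbBits (tupleCode l).reverse).map some) [] = (l, []) := by
        intro l
        have := decodeStrings_symbBits l []
        rw [List.append_nil] at this
        rw [this]
        rfl
      simp only [decodeChallenge, u, List.map_reverse, List.reverse_reverse, List.map_append,
        List.map_cons, List.cons_append, List.nil_append,
        decodeStrings_symbBits, h₁, h₂]
    obtain ⟨v, -, hv⟩ := hw u (by
      have h₁ := hb a x.1 x.2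
      have h₂ := hb a y.1 y.2
      have h₃ := length_le_length_tupleCode (I.vecCode a x.1)
      simp only [ConstraintInputs.vecCode, List.length_ofFn] at h₁ h₂ h₃
      simp only [u, hq, List.length_reverse, List.length_append, length_symbBits, List.length_cons,
        List.length_nil, List.length_ofFn, ConstraintInputs.vecCode, Polynomial.eval_add,
        Polynomial.eval_mul, Polynomial.eval_C]
      omega)
    have hfx : I.feasibleBit (I.enc a) (I.vecCode a x.1) = true :=
      (I.feasibleBit_enc a _).2 ⟨x, rfl⟩
    have hfy : I.feasibleBit (I.enc a) (I.vecCode a y.1) = true :=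
      (I.feasibleBit_enc a _).2 ⟨y, rfl⟩
    by_cases hfz : I.feasibleBit (I.enc a) (decodeResponse v).1 = true
    · obtain ⟨z, hz⟩ := (I.feasibleBit_enc a _).1 hfz
      rw [← hz] at hfz
      simp only [verifyBit, verify, hwf, checkedCondition, hu, hfx, hfy, ← hz, hfz, if_true] at hv
      exact ⟨z, (I.condition_eq_true_iff a x y z q Q hQ).1 hv⟩
    -- An infeasible response would have been rejected.
    · simp [verifyBit, verify, hwf, checkedCondition, hu, hfx, hfy, hfz] at hv

end ClassifierInputs

/-- Testing looseness belongs to `Π₂ᴾ`. -/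
theorem ConstraintInputs.inPi2P_looseness {ι : Type} (I : ConstraintInputs ι)
    (h : I.PolyTimeCheckable) : InPi2P I.looseness := by
  let I' : ClassifierInputs ι :=
    { I with
      K := fun _ => Unit
      classCode := fun _ _ => [true]
      classCode_injective := fun _ _ _ _ => rfl
      κ := fun _ _ => () }
  have hκ : I'.PolyTimeEvaluable := by
    obtain ⟨g, hg, ⟨m⟩⟩ := h.feasible
    -- The feasibility test doubles as the classifier: on feasible vectors it outputs `[true]`,
    -- which was chosen as the code of the only class.
    refine ⟨⟨m.toTM2ComputableAux, m.time, fun t => ?_⟩⟩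
    have := m.outputsFun (t.1, I.vecCode t.1 t.2.1)
    rwa [(hg (t.1, I.vecCode t.1 t.2.1)).2 ⟨t.2.1, t.2.2, rfl⟩] at this
  have := I'.inPi2P_disentangledness h hκ
  have hL : I.looseness = I'.disentangledness := by
    simp only [ConstraintInputs.looseness, ClassifierInputs.disentangledness]
    congr 1
    ext a
    exact isLoose_iff_isDisentangled_const _ _ ()
  rwa [hL]

theorem mainTheorem12 :
    -- testing looseness, and testing disentangledness, is in the class
    (∀ (ι : Type) (I : ConstraintInputs ι), I.PolyTimeCheckable → InPi2P I.looseness) ∧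
    (∀ (ι : Type) (I : ClassifierInputs ι),
      I.PolyTimeCheckable → I.PolyTimeEvaluable → InPi2P I.disentangledness) ∧
    -- the two characterizations, over an arbitrary feature space
    (∀ (F : Type*) (D : F → Type*) (C : Set (Set (∀ i, D i))) (P : Set F),
      IsLoose C P ↔
        ∀ x y : Feasible C, ∀ p ∈ P, ∃ z : Feasible C,
          (¬ AgreeOn {p} y.1 x.1 ∨ AgreeOn Pᶜ y.1 x.1) ∨
            (AgreeOn Pᶜ z.1 x.1 ∧ ¬ AgreeOn {p} z.1 x.1)) ∧
    (∀ (F : Type*) (D : F → Type*) (K : Type*) (C : Set (Set (∀ i, D i))) (P : Set F)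
      (κ : Feasible C → K),
      IsDisentangled C P κ ↔
        ∀ x y : Feasible C, ∀ Q : Set F, ∃ z : Feasible C,
          (¬ AgreeOn Pᶜ y.1 x.1 ∨ κ y = κ x) ∧
            (Q ∩ P = ∅ ∨ (AgreeOn Q z.1 x.1 ∧ κ z ≠ κ x) ∨
              (¬ AgreeOn Q y.1 x.1 ∨ AgreeOn Pᶜ y.1 x.1) ∨
              (AgreeOn Pᶜ z.1 x.1 ∧ ¬ AgreeOn Q z.1 x.1))) :=
  ⟨fun _ I h => I.inPi2P_looseness h, fun _ I h hκ => I.inPi2P_disentangledness h hκ,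
    fun _ _ C P => isLoose_iff_forall_exists C P,
    fun _ _ _ C P κ => isDisentangled_iff_forall_exists C P κ⟩
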